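/- Let $f(x,y)=\frac1n\sum_{i=1}^n f_i(x,y)$ ($n\ge 1$) on $\mathcal X\times\mathcal Y$, where $\mathcal X\subset\mathbb R^{d_x}$ and $\mathcal Y\subset\mathbb R^{d_y}$ are convex, closed and bounded with diameters $D_x$ and $D_y$. Suppose that the $f_i$ are differentiable and $L$-average smooth, $\frac1n\sum_{i}\|\nabla f_i(z)-\nabla f_i(z')\|^2\le L^2\|z-z'\|^2$ for all $z,z'\in\mathcal X\times\mathcal Y$, and that $f$ is convex in $x$ and concave in $y$. For a function $\phi$ let $\mathrm{gap}_\phi(\hat x,\hat y)=\max_{y\in\mathcal Y}\phi(\hat x,y)-\min_{x\in\mathcal X}\phi(x,\hat y)$; an $\varepsilon$-saddle point of $\phi$ is a point of $\mathcal X\times\mathcal Y$ with $\mathrm{gap}_\phi\le\varepsilon$. Let $0<\varepsilon\le 4L\min\{D_x^2,D_y^2\}$, $(x_0,y_0)\in\mathcal X\times\mathcal Y$, and $$f_\varepsilon(x,y)=f(x,y)+\frac{\varepsilon}{8D_x^2}\|x-x_0\|^2-\frac{\varepsilon}{8D_y^2}\|y-y_0\|^2 .$$ Algorithms. Put $L'=2L$,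 $\mu_x=\varepsilon/(8D_x^2)$, $\mu_y=\varepsilon/(8D_y^2)$, $\kappa_x=L'/\mu_x=16LD_x^2/\varepsilon$, $\kappa_y=L'/\mu_y=16LD_y^2/\varepsilon$, and let $P_C$ be the Euclidean projection onto $C$. For components $h_1,\dots,h_n$ with average $h$, write $g=(\nabla_xh,-\nabla_yh)$, $g_i=(\nabla_xh_i,-\nabla_yh_i)$. L-SVRE with step size $\tau$ and probability $p$ starts at $w_0=z_0$ and iterates, for $t=0,\dots,T-1$: $\bar z_t=(1-p)z_t+pw_t$; $z_{t+1/2}=P_{\mathcal X\times\mathcal Y}(\bar z_t-\tau g(w_t))$; $z_{t+1}=P_{\mathcal X\times\mathcal Y}(\bar z_t-\tau[g(w_t)+g_i(z_{t+1/2})-g_i(w_t)])$ with $i$ uniform in $\{1,\dots,n\}$; $w_{t+1}=z_{t+1}$ with probability $p$ and $w_{t+1}=w_t$ otherwise; it returns $z_T$. If $\mu_x\le\mu_y$, AL-SVRE is run on the components of $f_\varepsilon$ (those of $f$, each with the two quadratic terms added), starting at $(x_0,y_0)$ and $u_0=x_0$: for $k=1,\dots,K$, apply $T$ iterations of L-SVRE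 from $(x_{k-1},y_{k-1})$ to the components with $\frac\beta2\|x-u_{k-1}\|^2$ added, and get $(\tilde x_k,\tilde y_k)$; let $F_k=f_\varepsilon+\frac\beta2\|x-u_{k-1}\|^2$, $x_k=P_{\mathcal X}(\tilde x_k-\tau\nabla_xF_k(\tilde x_k,\tilde y_k))$, $y_k=P_{\mathcal Y}(\tilde y_k+\tau\nabla_yF_k(\tilde x_k,\tilde y_k))$, $u_k=x_k+\frac{1-\sqrt q}{1+\sqrt q}(x_k-x_{k-1})$; return $(x_K,y_K)$. Here $p=\frac1{2n}$, $q=\frac{\mu_x}{\mu_x+\beta}$, $\tau=\frac{1}{4\sqrt n(L'+\beta)}$, and $\beta=\mu_y-\mu_x$ if $\kappa_y\ge\sqrt n$, $\beta=L'/\sqrt n-\mu_x$ if $\kappa_x>\sqrt n>\kappa_y$, $\beta=0$ otherwise. If $\mu_x>\mu_y$, the same is done with the roles of the two variables exchanged (that is, for $\min_y\max_x(-f_\varepsilon)$). An SFO call is one evaluation of the gradient of one component at one point. Claim. There is a universal constant $C$, and for all $n,L,D_x,D_y,\varepsilon$ as above there are $K,T\in\mathbb N$ depending only on these five numbers, such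 that for every such problem and starting point the output $(\hat x,\hat y)$ always lies in $\mathcal X\times\mathcal Y$ and $$\mathbb E\big[\mathrm{gap}_{f_\varepsilon}(\hat x,\hat y)\big]\le\frac\varepsilon2,\qquad \mathbb E\big[\mathrm{gap}_{f}(\hat x,\hat y)\big]\le\varepsilon ;$$ every $\varepsilon/2$-saddle point of $f_\varepsilon$ is an $\varepsilon$-saddle point of $f$; and the expected number of SFO calls is at most $$C\Big(n+\frac{\sqrt n\,LD_xD_y}{\varepsilon}+n^{3/4}(D_x+D_y)\sqrt{\frac L\varepsilon}\Big)\log^2(n\kappa_x\kappa_y).$$ Since $\log^2(n\kappa_x\kappa_y)$ consists of logarithms of $n,\kappa_x,\kappa_y$, which $\tilde{\mathcal O}$ hides, this gives $\tilde{\mathcal O}\big(\big(n+\frac{\sqrt n LD_xD_y}{\varepsilon}+n^{3/4}(D_x+D_y)\sqrt{L/\varepsilon}\big)\log\frac1\varepsilon\big)$ for $\varepsilon\le\frac12$. -/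

import Mathlib

open scoped ENNReal Gradient

noncomputable section

/-! ### Finite-sum minimax problems on `X × Y` with the Euclidean norm on the product -/

section Problem

variable {E F : Type} [NormedAddCommGroup E] [InnerProductSpace ℝ E]
  [NormedAddCommGroup F] [InnerProductSpace ℝ F]

/-- The feasible set `X × Y`, inside the Euclidean product of the two spaces. -/
def feasible (X : Set E) (Y : Set F) : Set (WithLp 2 (E × F)) :=
  {z | z.fst ∈ X ∧ z.snd ∈ Y}

/-- The objective `(1/n) ∑ᵢ fᵢ`. -/
def average {V : Type} {n : ℕ} (f : Fin n → V → ℝ) (z : V) : ℝ :=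
  (1 / (n : ℝ)) * ∑ i, f i z

/-- The duality gap `max_{y ∈ Y} φ(x̂, y) - min_{x ∈ X} φ(x, ŷ)` at `z = (x̂, ŷ)`. -/
def dualityGap (φ : WithLp 2 (E × F) → ℝ) (X : Set E) (Y : Set F) (z : WithLp 2 (E × F)) : ℝ :=
  sSup ((fun y => φ (WithLp.toLp 2 (z.fst, y))) '' Y)
    - sInf ((fun x => φ (WithLp.toLp 2 (x, z.snd))) '' X)

/-- `z` is an `ε`-saddle point of `φ` on `X × Y`. -/
def IsEpsSaddle (φ : WithLp 2 (E × F) → ℝ) (X : Set E) (Y : Set F) (ε : ℝ)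
    (z : WithLp 2 (E × F)) : Prop :=
  z ∈ feasible X Y ∧ dualityGap φ X Y z ≤ ε

/-- `φ` is convex in the first and concave in the second variable on `X × Y`. -/
def ConvexConcave (φ : WithLp 2 (E × F) → ℝ) (X : Set E) (Y : Set F) : Prop :=
  (∀ y ∈ Y, ConvexOn ℝ X fun x => φ (WithLp.toLp 2 (x, y))) ∧
    ∀ x ∈ X, ConcaveOn ℝ Y fun y => φ (WithLp.toLp 2 (x, y))

/-- The components `fᵢ` are differentiable at every point of `Z` and `L`-average smooth on `Z`. -/
def AverageSmooth {V : Type} [NormedAddCommGroup V] [InnerProductSpace ℝ V] [CompleteSpace V]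
    {n : ℕ} (f : Fin n → V → ℝ) (Z : Set V) (L : ℝ) : Prop :=
  (∀ i, ∀ z ∈ Z, DifferentiableAt ℝ (f i) z) ∧
    ∀ z ∈ Z, ∀ z' ∈ Z,
      (1 / (n : ℝ)) * ∑ i, ‖∇ (f i) z - ∇ (f i) z'‖ ^ 2 ≤ L ^ 2 * ‖z - z'‖ ^ 2

/-- The regularised function
`φ(x, y) + ε / (8 Dx²) ‖x - x₀‖² - ε / (8 Dy²) ‖y - y₀‖²`, where `z₀ = (x₀, y₀)`. -/
def regularize (ε Dx Dy : ℝ) (z₀ : WithLp 2 (E × F)) (φ : WithLp 2 (E × F) → ℝ)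
    (z : WithLp 2 (E × F)) : ℝ :=
  φ z + ε / (8 * Dx ^ 2) * ‖z.fst - z₀.fst‖ ^ 2 - ε / (8 * Dy ^ 2) * ‖z.snd - z₀.snd‖ ^ 2

/-- Exchange of the two variables. -/
def swapVars (z : WithLp 2 (E × F)) : WithLp 2 (F × E) :=
  WithLp.toLp 2 (z.snd, z.fst)

/-- The same minimax problem with the roles of the variables exchanged: `(y, x) ↦ -φ(x, y)`. -/
def swapFun (φ : WithLp 2 (E × F) → ℝ) (z : WithLp 2 (F × E)) : ℝ :=
  -φ (swapVars z)

end Problem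

/-- The Euclidean projection `argmin_{u ∈ C} ‖u - z‖` onto a nonempty closed convex set `C`. -/
def proj {V : Type} [NormedAddCommGroup V] (C : Set V) (z : V) : V :=
  Classical.epsilon fun u => u ∈ C ∧ ∀ v ∈ C, ‖u - z‖ ≤ ‖v - z‖

/-! ### Random choices -/

/-- A coin that shows `true` with probability `p`. -/
def coin (p : unitInterval) : PMF Bool :=
  PMF.ofFintype (fun b => ENNReal.ofReal (if b then (p : ℝ) else 1 - (p : ℝ))) (by
    rw [Fintype.sum_bool, ← ENNReal.ofReal_add] <;> simp [p.2.1, p.2.2])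

/-- The expectation of a nonnegative function of the random outcome. -/
def expectation {α : Type} (P : PMF α) (φ : α → ℝ≥0∞) : ℝ≥0∞ :=
  ∑' a, P a * φ a

/-- The probability `1 / (2n)`. -/
def refreshProb (n : ℕ) [NeZero n] : unitInterval :=
  ⟨1 / (2 * (n : ℝ)), by positivity, by
    have h : (1 : ℝ) ≤ n := by exact_mod_cast NeZero.one_le
    rw [div_le_one (by positivity)]
    linarith⟩

/-! ### The algorithms, with a count of the stochastic first-order oracle calls

One call is one evaluation of the gradient of one component at one point; a full gradient of the
average of `n` components costs `n` calls. -/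

section Algorithms

variable {E F : Type} [NormedAddCommGroup E] [InnerProductSpace ℝ E] [CompleteSpace E]
  [NormedAddCommGroup F] [InnerProductSpace ℝ F] [CompleteSpace F]

/-- The gradient operator `g = (∇ₓ φ, -∇_y φ)`. -/
def saddleGrad (φ : WithLp 2 (E × F) → ℝ) (z : WithLp 2 (E × F)) : WithLp 2 (E × F) :=
  WithLp.toLp 2 ((∇ φ z).fst, -(∇ φ z).snd)

/-- The state of L-SVRE: current point `z`, reference point `w`, oracle calls so far. -/
structure SVREState (E F : Type) where
  z : WithLp 2 (E × F)
  w : WithLp 2 (E × F)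
  calls : ℕ

/-- One iteration of L-SVRE. The full gradient at `w` is kept from the moment when `w` was set, so
that an iteration costs two calls, and `n` more if `w` is refreshed. -/
def lsvreStep {n : ℕ} [NeZero n] (f : Fin n → WithLp 2 (E × F) → ℝ) (Z : Set (WithLp 2 (E × F)))
    (τ : ℝ) (p : unitInterval) (s : SVREState E F) : PMF (SVREState E F) :=
  let zbar := (1 - (p : ℝ)) • s.z + (p : ℝ) • s.w
  let zhalf := proj Z (zbar - τ • saddleGrad (average f) s.w)
  (PMF.uniformOfFintype (Fin n)).bind fun i =>
    let znew := proj Z (zbar - τ •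
      (saddleGrad (average f) s.w + saddleGrad (f i) zhalf - saddleGrad (f i) s.w))
    (coin p).bind fun b =>
      PMF.pure
        { z := znew
          w := if b then znew else s.w
          calls := s.calls + 2 + if b then n else 0 }

/-- The state of L-SVRE after `T` iterations; the full gradient at `w₀ = z₀` costs `n` calls. -/
def lsvreState {n : ℕ} [NeZero n] (f : Fin n → WithLp 2 (E × F) → ℝ) (Z : Set (WithLp 2 (E × F)))
    (z₀ : WithLp 2 (E × F)) (τ : ℝ) (p : unitInterval) : ℕ → PMF (SVREState E F)
  | 0 => PMF.pure { z := z₀, w := z₀, calls := n }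
  | T + 1 => (lsvreState f Z z₀ τ p T).bind (lsvreStep f Z τ p)

/-- L-SVRE: the law of the output and of the number of oracle calls. -/
def lsvre {n : ℕ} [NeZero n] (f : Fin n → WithLp 2 (E × F) → ℝ) (Z : Set (WithLp 2 (E × F)))
    (z₀ : WithLp 2 (E × F)) (τ : ℝ) (p : unitInterval) (T : ℕ) : PMF (WithLp 2 (E × F) × ℕ) :=
  (lsvreState f Z z₀ τ p T).map fun s => (s.z, s.calls)

/-- The proximal component `φ(x, y) + (β/2) ‖x - u‖²`. -/
def proximal (β : ℝ) (u : E) (φ : WithLp 2 (E × F) → ℝ) (z : WithLp 2 (E × F)) : ℝ :=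
  φ z + β / 2 * ‖z.fst - u‖ ^ 2

/-- The state of AL-SVRE: current point `z = (x, y)`, extrapolated point `u`, oracle calls so
far. -/
structure ALSVREState (E F : Type) where
  z : WithLp 2 (E × F)
  u : E
  calls : ℕ

/-- One iteration of AL-SVRE: L-SVRE on the proximal components, one projected gradient step
(`n` calls), extrapolation in the first variable. -/
def alsvreStep {n : ℕ} [NeZero n] (f : Fin n → WithLp 2 (E × F) → ℝ) (X : Set E) (Y : Set F)
    (β q : ℝ) (p : unitInterval) (τ : ℝ) (T : ℕ) (s : ALSVREState E F) :
    PMF (ALSVREState E F) :=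
  let γ := (1 - √q) / (1 + √q)
  let Fk := fun i => proximal β s.u (f i)
  (lsvre Fk (feasible X Y) s.z τ p T).map fun r =>
    let x := proj X (r.1.fst - τ • (∇ (average Fk) r.1).fst)
    let y := proj Y (r.1.snd + τ • (∇ (average Fk) r.1).snd)
    { z := WithLp.toLp 2 (x, y)
      u := x + γ • (x - s.z.fst)
      calls := s.calls + r.2 + n }

/-- The state of AL-SVRE after `K` iterations, with parameters `τ k` and `T k` in the `k`-th
iteration, `k = 1, …, K`. -/
def alsvreState {n : ℕ} [NeZero n] (f : Fin n → WithLp 2 (E × F) → ℝ) (X : Set E) (Y : Set F)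
    (z₀ : WithLp 2 (E × F)) (β q : ℝ) (p : unitInterval) (τ : ℕ → ℝ) (T : ℕ → ℕ) :
    ℕ → PMF (ALSVREState E F)
  | 0 => PMF.pure { z := z₀, u := z₀.fst, calls := 0 }
  | K + 1 => (alsvreState f X Y z₀ β q p τ T K).bind
      (alsvreStep f X Y β q p (τ (K + 1)) (T (K + 1)))

/-- AL-SVRE: the law of the output and of the number of oracle calls. -/
def alsvre {n : ℕ} [NeZero n] (f : Fin n → WithLp 2 (E × F) → ℝ) (X : Set E) (Y : Set F)
    (z₀ : WithLp 2 (E × F)) (β q : ℝ) (K : ℕ) (p : unitInterval) (τ : ℕ → ℝ) (T : ℕ → ℕ) :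
    PMF (WithLp 2 (E × F) × ℕ) :=
  (alsvreState f X Y z₀ β q p τ T K).map fun s => (s.z, s.calls)

/-- The proximal parameter `β` for an `L`-average smooth problem that is `μx`-strongly convex and
`μy`-strongly concave with `μx ≤ μy`. -/
def proxParam (n : ℕ) (L μx μy : ℝ) : ℝ :=
  if √n ≤ L / μy then μy - μx
  else if √n < L / μx then L / √n - μx
  else 0

/-- AL-SVRE with `K` outer and `T` inner iterations and the parameters `β` as above,
`q = μx / (μx + β)`, `p = 1 / (2n)`, `τₖ = 1 / (4 √n (L + β))`, for `μx ≤ μy`. -/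
def alsvreTuned {n : ℕ} [NeZero n] (f : Fin n → WithLp 2 (E × F) → ℝ) (X : Set E) (Y : Set F)
    (z₀ : WithLp 2 (E × F)) (L μx μy : ℝ) (K T : ℕ) : PMF (WithLp 2 (E × F) × ℕ) :=
  let β := proxParam n L μx μy
  alsvre f X Y z₀ β (μx / (μx + β)) K (refreshProb n) (fun _ => 1 / (4 * √n * (L + β)))
    (fun _ => T)

/-- The same for arbitrary `μx`, `μy`: the variable with the smaller modulus plays the role of the
first variable; if that is `y`, then the equivalent problem `min_y max_x -f` is solved. -/
def alsvreOriented {n : ℕ} [NeZero n] (f : Fin n → WithLp 2 (E × F) → ℝ) (X : Set E) (Y : Set F)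
    (z₀ : WithLp 2 (E × F)) (L μx μy : ℝ) (K T : ℕ) : PMF (WithLp 2 (E × F) × ℕ) :=
  if μx ≤ μy then alsvreTuned f X Y z₀ L μx μy K T
  else (alsvreTuned (fun i => swapFun (f i)) Y X (swapVars z₀) L μy μx K T).map
    fun r => (swapVars r.1, r.2)

end Algorithms

end

noncomputable section

open scoped RealInnerProductSpace

/-! ### Expectations of finite random choices, with values in `ℝ≥0∞`. -/

section Expectation

variable {α β : Type}

/-! The two quadratic terms of the regularised function are each at most ε/8 on the feasible set, so
adding them changes the duality gap by at most ε/4. They make the problem strongly convex and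
strongly concave, and it remains to reach expected gap ε/2 there. Exchanging the variables reduces
everything to Dy ≤ Dx, that is μx ≤ μy.

Inner loop. A saddle point solves the variational inequality of the strongly monotone operator g,
and L-SVRE is an extragradient method for it with variance reduction. Averaged over the index i, the
second step uses exactly g at the half-step point h, and the mean square distance between the
operators used in the two steps is at most Λ²‖w - h‖². Centring at the mixture of z and w produces
the term -p‖w - h‖², which absorbs this error as soon as τ²Λ² ≤ p/8. Hence (1-p)‖z - z*‖² + ‖w -
z*‖² shrinks in mean by a factor 1-θ, where 1/θ is of order n + √n(L'+β)/min(μx+β, μy)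
(`expectation_lsvreStep_le`).

Outer loop. This is an inexact accelerated proximal point method for the primal function x ↦ max_y.
The projected gradient step after each inner loop turns distance from the solution of the subproblem
into an error in its variational inequality (`inner_proj_step_le`), and this gives the proximal
inequality `IsInexactProx`. Applied at x* with weight √q and at the previous iterate with weight
1-√q, it makes a potential contract by 1-√q up to the error (`ALSVRESpec.potential_step_le`). The
first step bounds the potential by diameters alone, so no bound on the initial gap is needed
(`ALSVRESpec.potential_first_step_le`); the last one converts the potential into a duality gap at
the price μx Dx² = ε/8 (`ALSVRESpec.dualityGap_step_le`).

Cost. Powers of κx and n lost in these conversions only enter logarithms. Apart from two logarithms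
the number of calls is of order (n + √n(L'+β)/min(μx+β, μy))/√q, and the three regimes of β bring
this to n + √(nκxκy) + n^(3/4)√κx (`sqrt_mul_proxParam_le`). -/

theorem expectation_bind (P : PMF α) (Q : α → PMF β) (φ : β → ℝ≥0∞) :
    expectation (P.bind Q) φ = expectation P fun a => expectation (Q a) φ := by
  simp only [expectation, PMF.bind_apply, ← ENNReal.tsum_mul_left, ← ENNReal.tsum_mul_right]
  rw [ENNReal.tsum_comm]
  simp only [mul_assoc]

theorem expectation_pure (a : α) (φ : α → ℝ≥0∞) : expectation (PMF.pure a) φ = φ a := by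
  rw [expectation, tsum_eq_single a]
  · simp
  · intro b hb
    simp [hb]

theorem expectation_map (P : PMF α) (g : α → β) (φ : β → ℝ≥0∞) :
    expectation (P.map g) φ = expectation P fun a => φ (g a) := by
  rw [← PMF.bind_pure_comp, expectation_bind]
  simp only [Function.comp, expectation_pure]

theorem expectation_mono_of_support {P : PMF α} {φ ψ : α → ℝ≥0∞}
    (h : ∀ a ∈ P.support, φ a ≤ ψ a) : expectation P φ ≤ expectation P ψ := by
  refine ENNReal.tsum_le_tsum fun a => ?_
  by_cases ha : a ∈ P.support
  · exact mul_le_mul_right (h a ha) _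
  · rw [PMF.mem_support_iff, not_not] at ha
    simp [ha]

theorem expectation_add (P : PMF α) (φ ψ : α → ℝ≥0∞) :
    expectation P (fun a => φ a + ψ a) = expectation P φ + expectation P ψ := by
  simp only [expectation, mul_add, ENNReal.tsum_add]

theorem expectation_const_mul (P : PMF α) (c : ℝ≥0∞) (φ : α → ℝ≥0∞) :
    expectation P (fun a => c * φ a) = c * expectation P φ := by
  simp only [expectation, mul_left_comm _ c, ENNReal.tsum_mul_left]

theorem expectation_const (P : PMF α) (c : ℝ≥0∞) : expectation P (fun _ => c) = c := by
  simp only [expectation, ENNReal.tsum_mul_right, PMF.tsum_coe, one_mul]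

/-- An affine bound passes to the expectation. -/
theorem expectation_le_affine {P : PMF α} {φ ψ : α → ℝ} {c d r : ℝ} (hc : 0 ≤ c) (hd : 0 ≤ d)
    (hr : 0 ≤ r) (h : ∀ a ∈ P.support, φ a ≤ c * ψ a + d)
    (hE : expectation P (fun a => ENNReal.ofReal (ψ a)) ≤ ENNReal.ofReal r) :
    expectation P (fun a => ENNReal.ofReal (φ a)) ≤ ENNReal.ofReal (c * r + d) := by
  calc expectation P (fun a => ENNReal.ofReal (φ a))
      ≤ expectation P (fun a => ENNReal.ofReal c * ENNReal.ofReal (ψ a) + ENNReal.ofReal d) := by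
        refine expectation_mono_of_support fun a ha => ?_
        rw [← ENNReal.ofReal_mul hc]
        exact (ENNReal.ofReal_le_ofReal (h a ha)).trans ENNReal.ofReal_add_le
    _ = ENNReal.ofReal c * expectation P (fun a => ENNReal.ofReal (ψ a)) + ENNReal.ofReal d := by
        rw [expectation_add, expectation_const_mul, expectation_const]
    _ ≤ ENNReal.ofReal c * ENNReal.ofReal r + ENNReal.ofReal d := by gcongr
    _ = ENNReal.ofReal (c * r + d) := by
        rw [← ENNReal.ofReal_mul hc, ← ENNReal.ofReal_add (mul_nonneg hc hr) hd]

theorem expectation_uniform_fin {n : ℕ} [NeZero n] {φ : Fin n → ℝ} (h : ∀ i, 0 ≤ φ i) :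
    expectation (PMF.uniformOfFintype (Fin n)) (fun i => ENNReal.ofReal (φ i))
      = ENNReal.ofReal ((1 / (n : ℝ)) * ∑ i, φ i) := by
  have hn : (0 : ℝ) < n := by exact_mod_cast NeZero.pos n
  rw [ENNReal.ofReal_mul (by positivity), ENNReal.ofReal_sum_of_nonneg fun i _ => h i,
    expectation, tsum_fintype, Finset.mul_sum]
  refine Finset.sum_congr rfl fun i _ => ?_
  rw [PMF.uniformOfFintype_apply, Fintype.card_fin, one_div, ENNReal.ofReal_inv_of_pos hn,
    ENNReal.ofReal_natCast]

theorem expectation_coin {p : unitInterval} {φ : Bool → ℝ} (h : ∀ b, 0 ≤ φ b) :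
    expectation (coin p) (fun b => ENNReal.ofReal (φ b))
      = ENNReal.ofReal (p * φ true + (1 - p) * φ false) := by
  have h0 : (0 : ℝ) ≤ p := p.2.1
  have h1 : (0 : ℝ) ≤ 1 - p := sub_nonneg.2 p.2.2
  rw [expectation, tsum_fintype, Fintype.sum_bool, ENNReal.ofReal_add (mul_nonneg h0 (h _))
    (mul_nonneg h1 (h _)), ENNReal.ofReal_mul h0, ENNReal.ofReal_mul h1]
  simp [coin]

end Expectation

/-! ### Euclidean projections onto closed convex sets. -/

section Projection

variable {V : Type} [NormedAddCommGroup V] [InnerProductSpace ℝ V] [CompleteSpace V]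
  {C : Set V}

/-- `proj` is a choice term, so all its properties rest on the existence of a nearest point in a
complete convex set. -/
theorem proj_spec (hC : Convex ℝ C) (hc : IsClosed C) (hne : C.Nonempty) (z : V) :
    proj C z ∈ C ∧ ∀ v ∈ C, ‖proj C z - z‖ ≤ ‖v - z‖ := by
  refine Classical.epsilon_spec (p := fun u => u ∈ C ∧ ∀ v ∈ C, ‖u - z‖ ≤ ‖v - z‖) ?_
  obtain ⟨u, hu, h⟩ := exists_norm_eq_iInf_of_complete_convex hne hc.isComplete hC z
  refine ⟨u, hu, fun v hv => ?_⟩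
  rw [norm_sub_rev u, norm_sub_rev v, h]
  exact ciInf_le ⟨0, by rintro _ ⟨w, rfl⟩; exact norm_nonneg _⟩ (⟨v, hv⟩ : C)

theorem proj_mem (hC : Convex ℝ C) (hc : IsClosed C) (hne : C.Nonempty) (z : V) : proj C z ∈ C :=
  (proj_spec hC hc hne z).1

theorem inner_sub_proj_nonpos (hC : Convex ℝ C) (hc : IsClosed C) (z : V) {v : V} (hv : v ∈ C) :
    ⟪z - proj C z, v - proj C z⟫ ≤ 0 := by
  have hne : C.Nonempty := ⟨v, hv⟩
  obtain ⟨hm, h⟩ := proj_spec hC hc hne z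
  have := hne.to_subtype
  refine (norm_eq_iInf_iff_real_inner_le_zero hC hm).1 (le_antisymm ?_ ?_) v hv
  · refine le_ciInf fun w => ?_
    rw [norm_sub_rev, norm_sub_rev z]
    exact h w w.2
  · exact ciInf_le ⟨0, by rintro _ ⟨w, rfl⟩; exact norm_nonneg _⟩ (⟨_, hm⟩ : C)

/-- Adding the obtuse-angle inequalities of the two candidates, each tested at the other, gives
‖proj C z - u‖² ≤ 0. -/
theorem eq_proj_of_inner_nonpos (hC : Convex ℝ C) (hc : IsClosed C) {z u : V} (hu : u ∈ C)
    (h : ∀ v ∈ C, ⟪z - u, v - u⟫ ≤ 0) : proj C z = u := by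
  have h1 := h _ (proj_mem hC hc ⟨u, hu⟩ z)
  have h2 := inner_sub_proj_nonpos hC hc z hu
  have h3 : ⟪proj C z - u, proj C z - u⟫ ≤ 0 := by
    have : ⟪proj C z - u, proj C z - u⟫
        = ⟪z - u, proj C z - u⟫ + ⟪z - proj C z, u - proj C z⟫ := by
      rw [← neg_sub (proj C z) u, inner_neg_right, ← sub_eq_add_neg, ← inner_sub_left]
      congr 1
      abel
    linarith
  rw [real_inner_self_nonpos] at h3
  exact sub_eq_zero.1 h3

theorem norm_proj_sub_proj_le (hC : Convex ℝ C) (hc : IsClosed C) (hne : C.Nonempty) (z z' : V) :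
    ‖proj C z - proj C z'‖ ≤ ‖z - z'‖ := by
  have h1 := inner_sub_proj_nonpos hC hc z (proj_mem hC hc hne z')
  have h2 := inner_sub_proj_nonpos hC hc z' (proj_mem hC hc hne z)
  set a := proj C z
  set b := proj C z'
  have h3 : ‖a - b‖ ^ 2 ≤ ⟪z - z', a - b⟫ := by
    have : ⟪z - z', a - b⟫ - ⟪a - b, a - b⟫ = -⟪z - a, b - a⟫ - ⟪z' - b, a - b⟫ := by
      simp only [inner_sub_left, inner_sub_right]
      ring
    rw [real_inner_self_eq_norm_sq] at this
    linarith
  have h4 := real_inner_le_norm (z - z') (a - b)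
  by_contra! h
  nlinarith [norm_nonneg (z - z')]

end Projection

/-! ### Strongly monotone variational inequalities and the extragradient step. -/

section VariationalInequality

variable {V : Type} [NormedAddCommGroup V] [InnerProductSpace ℝ V]

/-- `g` is strongly monotone on `Z` with modulus `m`. -/
def StronglyMonotoneOn (g : V → V) (Z : Set V) (m : ℝ) : Prop :=
  ∀ z ∈ Z, ∀ z' ∈ Z, m * ‖z - z'‖ ^ 2 ≤ ⟪g z - g z', z - z'⟫

/-- `zs` solves the variational inequality of `g` on `Z`. -/
def SolvesVI (g : V → V) (Z : Set V) (zs : V) : Prop :=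
  zs ∈ Z ∧ ∀ z ∈ Z, 0 ≤ ⟪g zs, z - zs⟫

/-- The operators `G i` have average `g` on `Z` and are `Λ`-average Lipschitz on `Z`. -/
structure AverageLipschitz {n : ℕ} (G : Fin n → V → V) (g : V → V) (Z : Set V) (Λ : ℝ) :
    Prop where
  average_eq : ∀ z ∈ Z, g z = (1 / (n : ℝ)) • ∑ i, G i z
  sum_sq_le : ∀ z ∈ Z, ∀ z' ∈ Z,
    (1 / (n : ℝ)) * ∑ i, ‖G i z - G i z'‖ ^ 2 ≤ Λ ^ 2 * ‖z - z'‖ ^ 2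

theorem norm_average_sq_le {n : ℕ} [NeZero n] (a : Fin n → V) :
    ‖(1 / (n : ℝ)) • ∑ i, a i‖ ^ 2 ≤ (1 / (n : ℝ)) * ∑ i, ‖a i‖ ^ 2 := by
  have hn : (0 : ℝ) < n := by exact_mod_cast NeZero.pos n
  have h1 : ‖∑ i, a i‖ ^ 2 ≤ n * ∑ i, ‖a i‖ ^ 2 := by
    have h2 := sq_sum_le_card_mul_sum_sq (s := Finset.univ) (f := fun i => ‖a i‖)
    rw [Finset.card_univ, Fintype.card_fin] at h2
    exact (pow_le_pow_left₀ (norm_nonneg _) (norm_sum_le _ _) 2).trans h2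
  rw [norm_smul, mul_pow, Real.norm_eq_abs, sq_abs]
  calc (1 / (n : ℝ)) ^ 2 * ‖∑ i, a i‖ ^ 2 ≤ (1 / (n : ℝ)) ^ 2 * (n * ∑ i, ‖a i‖ ^ 2) := by gcongr
    _ = (1 / (n : ℝ)) * ∑ i, ‖a i‖ ^ 2 := by field_simp

theorem AverageLipschitz.norm_sub_le {n : ℕ} [NeZero n] {G : Fin n → V → V} {g : V → V}
    {Z : Set V} {Λ : ℝ} (h : AverageLipschitz G g Z Λ) (hΛ : 0 ≤ Λ) {z z' : V} (hz : z ∈ Z)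
    (hz' : z' ∈ Z) : ‖g z - g z'‖ ≤ Λ * ‖z - z'‖ := by
  refine le_of_sq_le_sq ?_ (by positivity)
  rw [h.average_eq z hz, h.average_eq z' hz', ← smul_sub, ← Finset.sum_sub_distrib, mul_pow]
  exact (norm_average_sq_le _).trans (h.sum_sq_le z hz z' hz')

variable [CompleteSpace V] {Z : Set V} {g : V → V}

/-- Strongly monotone Lipschitz variational inequalities have solutions. -/
theorem exists_solvesVI (hZ : Convex ℝ Z) (hc : IsClosed Z) (hne : Z.Nonempty) {m Λ : ℝ}
    (hm : 0 < m) (hΛ : 0 < Λ) (hg : StronglyMonotoneOn g Z m)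
    (hL : ∀ z ∈ Z, ∀ z' ∈ Z, ‖g z - g z'‖ ≤ Λ * ‖z - z'‖) : ∃ zs, SolvesVI g Z zs := by
  set s := m / Λ ^ 2 with hs
  have hs0 : 0 < s := by positivity
  -- Squared contraction factor of z ↦ proj (z - s g(z)) for s = m/Λ². If Z is a single point,
  -- nothing forces m ≤ Λ; the maximum with 0 covers this case.
  set r := max (1 - m ^ 2 / Λ ^ 2) 0 with hr
  have hr1 : r < 1 := by
    have : 0 < m ^ 2 / Λ ^ 2 := by positivity
    exact max_lt (by linarith) one_pos
  let Q : Z → Z := fun z => ⟨proj Z (z - s • g z), proj_mem hZ hc hne _⟩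
  have hQ : ContractingWith (Real.toNNReal (√r)) Q := by
    constructor
    · rw [← NNReal.coe_lt_coe, Real.coe_toNNReal _ (Real.sqrt_nonneg _), NNReal.coe_one,
        Real.sqrt_lt' one_pos]
      simpa using hr1
    · refine LipschitzWith.of_dist_le_mul fun z z' => ?_
      rw [Real.coe_toNNReal _ (Real.sqrt_nonneg _), Subtype.dist_eq, Subtype.dist_eq, dist_eq_norm,
        dist_eq_norm]
      refine (norm_proj_sub_proj_le hZ hc hne _ _).trans ?_
      refine le_of_sq_le_sq ?_ (by positivity)
      have h1 := hg z z.2 z' z'.2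
      have h2 := hL z z.2 z' z'.2
      have h3 : (z : V) - s • g z - (z' - s • g z') = (z - z') - s • (g z - g z') := by
        rw [smul_sub]; abel
      rw [h3, norm_sub_sq_real, inner_smul_right, real_inner_comm, norm_smul, mul_pow,
        Real.norm_eq_abs, sq_abs, mul_pow, Real.sq_sqrt (le_max_right _ _)]
      have h4 : s ^ 2 * ‖g z - g z'‖ ^ 2 ≤ s * m * ‖(z : V) - z'‖ ^ 2 := by
        calc s ^ 2 * ‖g z - g z'‖ ^ 2 ≤ s ^ 2 * (Λ * ‖(z : V) - z'‖) ^ 2 := by gcongr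
          _ = s * m * ‖(z : V) - z'‖ ^ 2 := by rw [hs]; field_simp
      have h5 : (1 - s * m) * ‖(z : V) - z'‖ ^ 2 ≤ r * ‖(z : V) - z'‖ ^ 2 := by
        have : 1 - s * m ≤ r := le_max_of_le_left (by rw [hs]; apply le_of_eq; ring)
        gcongr
      nlinarith [mul_le_mul_of_nonneg_left h1 hs0.le]
  have := hne.to_subtype
  have := hc.isComplete.completeSpace_coe
  have hfix := hQ.fixedPoint_isFixedPt
  set z := ContractingWith.fixedPoint Q hQ
  have hz : proj Z ((z : V) - s • g z) = z := congrArg Subtype.val hfix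
  refine ⟨z, z.2, fun v hv => ?_⟩
  have h := inner_sub_proj_nonpos hZ hc ((z : V) - s • g z) hv
  rw [hz, sub_sub_cancel_left, inner_neg_left, real_inner_smul_left] at h
  by_contra! h'
  nlinarith

theorem SolvesVI.eq_proj (hZ : Convex ℝ Z) (hc : IsClosed Z) {zs : V} (h : SolvesVI g Z zs)
    {τ : ℝ} (hτ : 0 ≤ τ) : proj Z (zs - τ • g zs) = zs := by
  refine eq_proj_of_inner_nonpos hZ hc h.1 fun v hv => ?_
  rw [sub_sub_cancel_left, inner_neg_left, real_inner_smul_left]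
  exact neg_nonpos.2 (mul_nonneg hτ (h.2 v hv))

/-- The two projections of an extragradient step. -/
theorem extragradient_step_le (hZ : Convex ℝ Z) (hc : IsClosed Z) {zs : V} (hzs : zs ∈ Z)
    (zbar a b : V) (τ : ℝ) :
    ‖proj Z (zbar - τ • b) - zs‖ ^ 2 ≤ ‖zbar - zs‖ ^ 2 - ‖zbar - proj Z (zbar - τ • a)‖ ^ 2
      + 2 * τ * ⟪b, zs - proj Z (zbar - τ • a)⟫ + τ ^ 2 * ‖b - a‖ ^ 2 := by
  have h1 := inner_sub_proj_nonpos hZ hc (zbar - τ • b) hzs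
  have h2 := inner_sub_proj_nonpos hZ hc (zbar - τ • a)
    (proj_mem hZ hc ⟨zs, hzs⟩ (zbar - τ • b))
  set h := proj Z (zbar - τ • a)
  set u := proj Z (zbar - τ • b)
  -- This is Young's inequality for the cross term 2τ⟪b - a, h - u⟫; the ‖u - h‖² it costs is what
  -- `h2` leaves over.
  have h3 : 0 ≤ ‖(u - h) + τ • (b - a)‖ ^ 2 := by positivity
  simp only [← real_inner_self_eq_norm_sq, inner_sub_left, inner_sub_right, inner_add_left,
    inner_add_right, real_inner_smul_left, real_inner_smul_right] at *
  simp only [real_inner_comm a b, real_inner_comm u h, real_inner_comm u zs, real_inner_comm u zbar,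
    real_inner_comm h zbar, real_inner_comm zs zbar, real_inner_comm u a, real_inner_comm u b,
    real_inner_comm h a, real_inner_comm h b] at h1 h2 h3 ⊢
  linarith

end VariationalInequality

/-! ### One variance-reduced extragradient step, averaged over the component. -/

section Contraction

variable {V : Type} [NormedAddCommGroup V] [InnerProductSpace ℝ V]

theorem norm_sub_sq_le_two_mul (a b c : V) : ‖a - c‖ ^ 2 ≤ 2 * ‖a - b‖ ^ 2 + 2 * ‖b - c‖ ^ 2 := by
  have h := parallelogram_law_with_norm ℝ (a - b) (b - c)
  rw [sub_add_sub_cancel] at h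
  nlinarith [norm_nonneg (a - b - (b - c))]

/-- Applied with v = zs and with v = h, the terms in ‖z - w‖² cancel in the difference, which leaves
the negative multiples of ‖z - h‖² and ‖w - h‖². -/
theorem norm_convex_comb_sub_sq (z w v : V) (p : ℝ) :
    ‖(1 - p) • z + p • w - v‖ ^ 2
      = (1 - p) * ‖z - v‖ ^ 2 + p * ‖w - v‖ ^ 2 - p * (1 - p) * ‖z - w‖ ^ 2 := by
  have h : (1 - p) • z + p • w - v = (1 - p) • (z - v) + p • (w - v) := by module
  have h' : z - w = (z - v) - (w - v) := by abel
  rw [h, h', norm_add_sq_real, norm_sub_sq_real (z - v), norm_smul, norm_smul, mul_pow, mul_pow,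
    Real.norm_eq_abs, Real.norm_eq_abs, sq_abs, sq_abs, real_inner_smul_left,
    real_inner_smul_right]
  ring

variable [CompleteSpace V] {Z : Set V} {n : ℕ} [NeZero n] {G : Fin n → V → V} {g : V → V}

theorem average_extragradient_le (hZ : Convex ℝ Z) (hc : IsClosed Z) {Λ m τ p : ℝ}
    (hG : AverageLipschitz G g Z Λ) (hm : StronglyMonotoneOn g Z m) (hτ : 0 ≤ τ) {zs z w : V}
    (hzs : SolvesVI g Z zs) (hw : w ∈ Z) :
    let zbar := (1 - p) • z + p • w
    let h := proj Z (zbar - τ • g w)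
    (1 / (n : ℝ)) * ∑ i, ‖proj Z (zbar - τ • (g w + G i h - G i w)) - zs‖ ^ 2
      ≤ (1 - p) * ‖z - zs‖ ^ 2 + p * ‖w - zs‖ ^ 2 - (1 - p) * ‖z - h‖ ^ 2 - p * ‖w - h‖ ^ 2
        - 2 * τ * m * ‖h - zs‖ ^ 2 + τ ^ 2 * Λ ^ 2 * ‖w - h‖ ^ 2 := by
  intro zbar h
  have hn : (0 : ℝ) < n := by exact_mod_cast NeZero.pos n
  have hh : h ∈ Z := proj_mem hZ hc ⟨zs, hzs.1⟩ _
  have h1 : ∀ i, ‖proj Z (zbar - τ • (g w + G i h - G i w)) - zs‖ ^ 2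
      ≤ (‖zbar - zs‖ ^ 2 - ‖zbar - h‖ ^ 2) + 2 * τ * ⟪g w + G i h - G i w, zs - h⟫
        + τ ^ 2 * ‖G i h - G i w‖ ^ 2 := fun i => by
    have := extragradient_step_le hZ hc hzs.1 zbar (g w) (g w + G i h - G i w) τ
    rwa [show g w + G i h - G i w - g w = G i h - G i w by abel] at this
  -- Unbiasedness: h does not depend on i, so averaging cancels g w against the mean of the G i w.
  have h2 : (1 / (n : ℝ)) * ∑ i, ⟪g w + G i h - G i w, zs - h⟫ = ⟪g h, zs - h⟫ := by
    rw [← sum_inner, ← real_inner_smul_left]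
    congr 1
    rw [Finset.sum_sub_distrib, Finset.sum_add_distrib, Finset.sum_const, Finset.card_univ,
      Fintype.card_fin, smul_sub, smul_add, ← hG.average_eq h hh, ← hG.average_eq w hw,
      ← Nat.cast_smul_eq_nsmul ℝ, smul_smul, one_div_mul_cancel hn.ne', one_smul]
    abel
  have h3 : (1 / (n : ℝ)) * ∑ _i : Fin n, (‖zbar - zs‖ ^ 2 - ‖zbar - h‖ ^ 2)
      = ‖zbar - zs‖ ^ 2 - ‖zbar - h‖ ^ 2 := by
    rw [Finset.sum_const, Finset.card_univ, Fintype.card_fin, nsmul_eq_mul]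
    field_simp
  have h4 : (1 / (n : ℝ)) * ∑ i, ‖proj Z (zbar - τ • (g w + G i h - G i w)) - zs‖ ^ 2
      ≤ (‖zbar - zs‖ ^ 2 - ‖zbar - h‖ ^ 2) + 2 * τ * ⟪g h, zs - h⟫
        + τ ^ 2 * ((1 / (n : ℝ)) * ∑ i, ‖G i h - G i w‖ ^ 2) := by
    calc _ ≤ (1 / (n : ℝ)) * ∑ i, ((‖zbar - zs‖ ^ 2 - ‖zbar - h‖ ^ 2)
          + 2 * τ * ⟪g w + G i h - G i w, zs - h⟫ + τ ^ 2 * ‖G i h - G i w‖ ^ 2) := by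
          gcongr with i
          exact h1 i
      _ = _ := by
          rw [Finset.sum_add_distrib, Finset.sum_add_distrib, ← Finset.mul_sum, ← Finset.mul_sum,
            mul_add, mul_add, h3, ← h2]
          ring
  have h5 := mul_le_mul_of_nonneg_left (hG.sum_sq_le h hh w hw) (sq_nonneg τ)
  have h6 : ⟪g h, zs - h⟫ ≤ -(m * ‖h - zs‖ ^ 2) := by
    have h7 := hm h hh zs hzs.1
    have h8 := hzs.2 h hh
    rw [inner_sub_left] at h7
    rw [← neg_sub, inner_neg_right]
    linarith
  have h9 := mul_le_mul_of_nonneg_left h6 hτ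
  rw [norm_convex_comb_sub_sq, norm_convex_comb_sub_sq] at h4
  rw [norm_sub_rev h w] at h5
  linarith

end Contraction

/-! ### Linear convergence and cost of L-SVRE. -/

section LSVRE

variable {E F : Type} [NormedAddCommGroup E] [InnerProductSpace ℝ E] [CompleteSpace E]
  [NormedAddCommGroup F] [InnerProductSpace ℝ F] [CompleteSpace F]
  {n : ℕ} [NeZero n] {f : Fin n → WithLp 2 (E × F) → ℝ} {Z : Set (WithLp 2 (E × F))}

theorem lsvreStep_mem (hZ : Convex ℝ Z) (hc : IsClosed Z) {τ : ℝ} {p : unitInterval}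
    {s s' : SVREState E F} (hw : s.w ∈ Z) (hs : s' ∈ (lsvreStep f Z τ p s).support) :
    s'.z ∈ Z ∧ s'.w ∈ Z := by
  simp only [lsvreStep, PMF.mem_support_bind_iff, PMF.mem_support_pure_iff] at hs
  obtain ⟨i, -, b, -, rfl⟩ := hs
  have := proj_mem hZ hc ⟨_, hw⟩
  refine ⟨this _, ?_⟩
  cases b
  · exact hw
  · exact this _

theorem lsvreState_mem (hZ : Convex ℝ Z) (hc : IsClosed Z) {z₀ : WithLp 2 (E × F)} (hz : z₀ ∈ Z)
    {τ : ℝ} {p : unitInterval} (T : ℕ) {s : SVREState E F}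
    (hs : s ∈ (lsvreState f Z z₀ τ p T).support) : s.z ∈ Z ∧ s.w ∈ Z := by
  induction T generalizing s with
  | zero =>
    simp only [lsvreState, PMF.mem_support_pure_iff] at hs
    subst hs
    exact ⟨hz, hz⟩
  | succ T ih =>
    simp only [lsvreState, PMF.mem_support_bind_iff] at hs
    obtain ⟨s', hs', h⟩ := hs
    exact lsvreStep_mem hZ hc (ih hs').2 h

/-- The Lyapunov function of L-SVRE. -/
def lsvrePotential (p : unitInterval) (zs : WithLp 2 (E × F)) (s : SVREState E F) : ℝ :=
  (1 - (p : ℝ)) * ‖s.z - zs‖ ^ 2 + ‖s.w - zs‖ ^ 2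

theorem lsvrePotential_nonneg (p : unitInterval) (zs : WithLp 2 (E × F)) (s : SVREState E F) :
    0 ≤ lsvrePotential p zs s := by
  have := sub_nonneg.2 p.2.2
  rw [lsvrePotential]
  positivity

/-- The averaged step leaves negative multiples of ‖z - h‖², ‖w - h‖² and ‖h - zs‖². Splitting the
distances to zs at h bounds θ times the potential by these, and the conditions on θ are what this
requires. -/
theorem expectation_lsvreStep_le (hZ : Convex ℝ Z) (hc : IsClosed Z) {Λ m τ θ : ℝ}
    {p : unitInterval}
    (hG : AverageLipschitz (fun i => saddleGrad (f i)) (saddleGrad (average f)) Z Λ)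
    (hm : StronglyMonotoneOn (saddleGrad (average f)) Z m) (hτ : 0 ≤ τ) (hp : (p : ℝ) ≤ 1 / 2)
    (hτΛ : τ ^ 2 * Λ ^ 2 ≤ p / 8) (hθ : 0 ≤ θ) (hθp : θ ≤ p / 4) (hθm : θ ≤ τ * m / 4)
    {zs : WithLp 2 (E × F)} (hzs : SolvesVI (saddleGrad (average f)) Z zs) {s : SVREState E F}
    (hw : s.w ∈ Z) :
    expectation (lsvreStep f Z τ p s) (fun s' => ENNReal.ofReal (lsvrePotential p zs s'))
      ≤ ENNReal.ofReal ((1 - θ) * lsvrePotential p zs s) := by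
  have hp0 : (0 : ℝ) ≤ p := p.2.1
  have hp1 : (0 : ℝ) ≤ 1 - p := by linarith
  have hn : (0 : ℝ) < n := by exact_mod_cast NeZero.pos n
  have key := average_extragradient_le (p := p) (z := s.z) hZ hc hG hm hτ hzs hw
  simp only [lsvreStep, expectation_bind, expectation_pure]
  set zbar := (1 - (p : ℝ)) • s.z + (p : ℝ) • s.w
  set h := proj Z (zbar - τ • saddleGrad (average f) s.w)
  set zn := fun i => proj Z (zbar - τ •
      (saddleGrad (average f) s.w + saddleGrad (f i) h - saddleGrad (f i) s.w)) with hzn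
  -- The weight 1-p in the potential is chosen for this: averaging over the coin gives the new point
  -- total weight (1-p) + p = 1 and the old w weight 1-p.
  have h1 : ∀ i, expectation (coin p) (fun b => ENNReal.ofReal (lsvrePotential p zs
        { z := zn i, w := if b then zn i else s.w, calls := s.calls + 2 + if b then n else 0 }))
      = ENNReal.ofReal (‖zn i - zs‖ ^ 2 + (1 - p) * ‖s.w - zs‖ ^ 2) := fun i => by
    rw [expectation_coin fun b => lsvrePotential_nonneg _ _ _]
    simp only [lsvrePotential]
    congr 1
    simp
    ring
  refine (congrArg (expectation _) (funext h1)).trans_le ?_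
  rw [expectation_uniform_fin fun i => by positivity]
  refine ENNReal.ofReal_le_ofReal ?_
  rw [Finset.sum_add_distrib, Finset.sum_const, Finset.card_univ, Fintype.card_fin, nsmul_eq_mul,
    mul_add, ← mul_assoc (1 / (n : ℝ)) n, one_div_mul_cancel hn.ne', one_mul, lsvrePotential]
  have h2 := norm_sub_sq_le_two_mul s.z h zs
  have h3 := norm_sub_sq_le_two_mul s.w h zs
  have h4 : τ ^ 2 * Λ ^ 2 * ‖s.w - h‖ ^ 2 ≤ p / 8 * ‖s.w - h‖ ^ 2 := by gcongr
  have h5 : θ * ((1 - p) * ‖s.z - zs‖ ^ 2)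
      ≤ θ * ((1 - p) * (2 * ‖s.z - h‖ ^ 2 + 2 * ‖h - zs‖ ^ 2)) := by gcongr
  have h6 : θ * ‖s.w - zs‖ ^ 2 ≤ θ * (2 * ‖s.w - h‖ ^ 2 + 2 * ‖h - zs‖ ^ 2) := by gcongr
  have h7 : θ * ‖s.w - h‖ ^ 2 ≤ p / 4 * ‖s.w - h‖ ^ 2 := by gcongr
  have h8 : θ * ‖h - zs‖ ^ 2 ≤ τ * m / 4 * ‖h - zs‖ ^ 2 := by gcongr
  have h9 : θ * ((1 - p) * ‖s.z - h‖ ^ 2) ≤ 1 / 8 * ((1 - p) * ‖s.z - h‖ ^ 2) := by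
    gcongr
    linarith
  have h10 : 0 ≤ p * (θ * ‖h - zs‖ ^ 2) := by positivity
  have h11 : 0 ≤ (1 - p) * ‖s.z - h‖ ^ 2 := by positivity
  have h12 : 0 ≤ p * ‖s.w - h‖ ^ 2 := by positivity
  have h13 : 0 ≤ θ * ‖h - zs‖ ^ 2 := by positivity
  simp only [hzn] at key ⊢
  linarith

theorem expectation_lsvreState_le (hZ : Convex ℝ Z) (hc : IsClosed Z) {Λ m τ θ : ℝ}
    {p : unitInterval}
    (hG : AverageLipschitz (fun i => saddleGrad (f i)) (saddleGrad (average f)) Z Λ)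
    (hm : StronglyMonotoneOn (saddleGrad (average f)) Z m) (hτ : 0 ≤ τ) (hp : (p : ℝ) ≤ 1 / 2)
    (hτΛ : τ ^ 2 * Λ ^ 2 ≤ p / 8) (hθ : 0 ≤ θ) (hθp : θ ≤ p / 4) (hθm : θ ≤ τ * m / 4)
    {zs z₀ : WithLp 2 (E × F)} (hzs : SolvesVI (saddleGrad (average f)) Z zs) (hz₀ : z₀ ∈ Z)
    (T : ℕ) :
    expectation (lsvreState f Z z₀ τ p T) (fun s => ENNReal.ofReal (lsvrePotential p zs s))
      ≤ ENNReal.ofReal ((1 - θ) ^ T * (2 * ‖z₀ - zs‖ ^ 2)) := by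
  have hθ1 : 0 ≤ 1 - θ := by linarith
  induction T with
  | zero =>
    rw [lsvreState, expectation_pure]
    refine ENNReal.ofReal_le_ofReal ?_
    have := mul_nonneg p.2.1 (sq_nonneg ‖z₀ - zs‖)
    simp only [lsvrePotential]
    linarith
  | succ T ih =>
    rw [lsvreState, expectation_bind]
    calc _ ≤ expectation (lsvreState f Z z₀ τ p T)
          (fun s => ENNReal.ofReal ((1 - θ) * lsvrePotential p zs s)) :=
        expectation_mono_of_support fun s hs => expectation_lsvreStep_le hZ hc hG hm hτ hp hτΛ hθ
          hθp hθm hzs (lsvreState_mem hZ hc hz₀ T hs).2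
      _ ≤ ENNReal.ofReal ((1 - θ) * ((1 - θ) ^ T * (2 * ‖z₀ - zs‖ ^ 2)) + 0) :=
        expectation_le_affine hθ1 le_rfl (by positivity) (fun s _ => by rw [add_zero])
          ih
      _ = _ := by rw [add_zero, pow_succ']; ring_nf

/-- Linear convergence of L-SVRE. -/
theorem expectation_lsvre_le (hZ : Convex ℝ Z) (hc : IsClosed Z) {Λ m τ θ : ℝ}
    {p : unitInterval}
    (hG : AverageLipschitz (fun i => saddleGrad (f i)) (saddleGrad (average f)) Z Λ)
    (hm : StronglyMonotoneOn (saddleGrad (average f)) Z m) (hτ : 0 ≤ τ) (hp : (p : ℝ) ≤ 1 / 2)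
    (hτΛ : τ ^ 2 * Λ ^ 2 ≤ p / 8) (hθ : 0 ≤ θ) (hθp : θ ≤ p / 4) (hθm : θ ≤ τ * m / 4)
    {zs z₀ : WithLp 2 (E × F)} (hzs : SolvesVI (saddleGrad (average f)) Z zs) (hz₀ : z₀ ∈ Z)
    (T : ℕ) :
    expectation (lsvre f Z z₀ τ p T) (fun r => ENNReal.ofReal (‖r.1 - zs‖ ^ 2))
      ≤ ENNReal.ofReal (4 * (1 - θ) ^ T * ‖z₀ - zs‖ ^ 2) := by
  have hθ1 : 0 ≤ 1 - θ := by linarith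
  rw [lsvre, expectation_map]
  -- Since p ≤ 1/2, the squared distance is at most twice the potential; the other factor 2 of the 4
  -- comes from the initial potential.
  refine (expectation_le_affine (c := 2) (d := 0) (by norm_num) le_rfl (by positivity)
    (fun s _ => ?_)
    (expectation_lsvreState_le hZ hc hG hm hτ hp hτΛ hθ hθp hθm hzs hz₀ T)).trans_eq
    (by ring_nf)
  rw [lsvrePotential]
  nlinarith [sq_nonneg ‖s.w - zs‖, sq_nonneg ‖s.z - zs‖]

theorem lsvre_mem (hZ : Convex ℝ Z) (hc : IsClosed Z) {z₀ : WithLp 2 (E × F)} (hz : z₀ ∈ Z)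
    {τ : ℝ} {p : unitInterval} (T : ℕ) {r : WithLp 2 (E × F) × ℕ}
    (hr : r ∈ (lsvre f Z z₀ τ p T).support) : r.1 ∈ Z := by
  rw [lsvre, PMF.mem_support_map_iff] at hr
  obtain ⟨s, hs, rfl⟩ := hr
  exact (lsvreState_mem hZ hc hz T hs).1

/-- A refresh costs n calls with probability 1/(2n), so an iteration costs 2 + 1/2 in mean. -/
theorem expectation_lsvre_calls (Z : Set (WithLp 2 (E × F))) (z₀ : WithLp 2 (E × F)) (τ : ℝ)
    (T : ℕ) :
    expectation (lsvre f Z z₀ τ (refreshProb n) T) (fun r => (r.2 : ℝ≥0∞))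
      = ENNReal.ofReal (n + T * (5 / 2)) := by
  have hn : (0 : ℝ) < n := by exact_mod_cast NeZero.pos n
  have step : ∀ s, expectation (lsvreStep f Z τ (refreshProb n) s) (fun s' => (s'.calls : ℝ≥0∞))
      = s.calls + ENNReal.ofReal (5 / 2) := fun s => by
    simp only [lsvreStep, expectation_bind, expectation_pure]
    have h1 : ∀ b : Bool, ((s.calls + 2 + if b then n else 0 : ℕ) : ℝ≥0∞)
        = ENNReal.ofReal (s.calls + 2 + if b then n else 0) := fun b => by
      rw [← ENNReal.ofReal_natCast]
      cases b <;> simp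
    simp only [h1]
    rw [expectation_coin fun b => by positivity, expectation_const, ← ENNReal.ofReal_natCast,
      ← ENNReal.ofReal_add (by positivity) (by positivity)]
    congr 1
    simp only [refreshProb, if_true, Bool.false_eq_true, if_false]
    field_simp
    ring
  rw [lsvre, expectation_map]
  induction T with
  | zero => simp [lsvreState, expectation_pure]
  | succ T ih =>
    rw [lsvreState, expectation_bind]
    simp only [step]
    rw [expectation_add, expectation_const, ih, ← ENNReal.ofReal_add (by positivity)
      (by positivity)]
    congr 1
    push_cast
    ring

end LSVRE

/-! ### Gradients of the objective with added quadratic terms. -/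

section Gradients

theorem ConvexOn.add_fderiv_le {E : Type} [NormedAddCommGroup E] [NormedSpace ℝ E] {X : Set E}
    {φ : E → ℝ} (h : ConvexOn ℝ X φ) {x x' : E} (hx : x ∈ X) (hx' : x' ∈ X) {φ' : E →L[ℝ] ℝ}
    (hφ : HasFDerivAt φ φ' x) : φ x + φ' (x' - x) ≤ φ x' := by
  have h1 := h.comp_affineMap (AffineMap.lineMap x x')
  have h2 : HasDerivAt (φ ∘ AffineMap.lineMap x x') (φ' (x' - x)) (0 : ℝ) := by
    refine HasFDerivAt.comp_hasDerivAt (0 : ℝ) (by simpa using hφ) ?_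
    simpa using AffineMap.hasDerivAt_lineMap (a := x) (b := x') (x := (0 : ℝ))
  have h3 := h1.le_slope_of_hasDerivAt (x := 0) (y := 1) (by simpa using hx) (by simpa using hx')
    one_pos h2
  simp only [slope_def_field, Function.comp, AffineMap.lineMap_apply_one,
    AffineMap.lineMap_apply_zero, sub_zero, div_one] at h3
  linarith

variable {E F : Type} [NormedAddCommGroup E] [InnerProductSpace ℝ E] [CompleteSpace E]
  [NormedAddCommGroup F] [InnerProductSpace ℝ F] [CompleteSpace F]
  {φ : WithLp 2 (E × F) → ℝ} {d z : WithLp 2 (E × F)}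

theorem norm_sq_eq_fst_snd (z : WithLp 2 (E × F)) : ‖z‖ ^ 2 = ‖z.fst‖ ^ 2 + ‖z.snd‖ ^ 2 :=
  WithLp.prod_norm_sq_eq_of_L2 z

theorem inner_eq_fst_snd (z z' : WithLp 2 (E × F)) :
    ⟪z, z'⟫ = ⟪z.fst, z'.fst⟫ + ⟪z.snd, z'.snd⟫ :=
  WithLp.prod_inner_apply z z'

theorem hasGradientAt_of_inner {V : Type} [NormedAddCommGroup V] [InnerProductSpace ℝ V]
    [CompleteSpace V] {φ : V → ℝ} {φ' : V →L[ℝ] ℝ} {z d : V} (h : HasFDerivAt φ φ' z)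
    (hd : ∀ v, φ' v = ⟪d, v⟫) : HasGradientAt φ d z := by
  have : InnerProductSpace.toDual ℝ V d = φ' := by
    ext v
    simp [hd]
  rwa [hasGradientAt_iff_hasFDerivAt, this]

theorem HasGradientAt.average {V : Type} [NormedAddCommGroup V] [InnerProductSpace ℝ V]
    [CompleteSpace V] {n : ℕ} {f : Fin n → V → ℝ} {d : Fin n → V} {z : V}
    (h : ∀ i, HasGradientAt (f i) (d i) z) :
    HasGradientAt (average f) ((1 / (n : ℝ)) • ∑ i, d i) z := by
  refine hasGradientAt_of_inner ((HasFDerivAt.fun_sum fun i (_ : i ∈ Finset.univ) =>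
    (hasGradientAt_iff_hasFDerivAt.1 (h i))).const_mul (1 / (n : ℝ))) fun v => ?_
  simp [real_inner_smul_left, sum_inner]

theorem hasFDerivAt_norm_fst_sub_sq (u : E) (z : WithLp 2 (E × F)) :
    HasFDerivAt (fun z : WithLp 2 (E × F) => ‖z.fst - u‖ ^ 2)
      (2 • (innerSL ℝ (z.fst - u)) ∘L WithLp.fstL 2 ℝ E F) z :=
  ((WithLp.fstL 2 ℝ E F).hasFDerivAt.sub_const u).norm_sq

theorem hasFDerivAt_norm_snd_sub_sq (u : F) (z : WithLp 2 (E × F)) :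
    HasFDerivAt (fun z : WithLp 2 (E × F) => ‖z.snd - u‖ ^ 2)
      (2 • (innerSL ℝ (z.snd - u)) ∘L WithLp.sndL 2 ℝ E F) z :=
  ((WithLp.sndL 2 ℝ E F).hasFDerivAt.sub_const u).norm_sq

theorem HasGradientAt.proximal (h : HasGradientAt φ d z) (β : ℝ) (u : E) :
    HasGradientAt (proximal β u φ) (WithLp.toLp 2 (d.fst + β • (z.fst - u), d.snd)) z := by
  refine hasGradientAt_of_inner ((hasGradientAt_iff_hasFDerivAt.1 h).add
    ((hasFDerivAt_norm_fst_sub_sq u z).const_mul (β / 2))) fun v => ?_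
  have h1 : WithLp.fstL 2 ℝ E F v = v.fst := rfl
  rw [inner_eq_fst_snd]
  simp [h1, inner_eq_fst_snd d v, inner_add_left, inner_sub_left, real_inner_smul_left]
  ring

theorem HasGradientAt.regularize (h : HasGradientAt φ d z) (ε Dx Dy : ℝ)
    (z₀ : WithLp 2 (E × F)) :
    HasGradientAt (regularize ε Dx Dy z₀ φ)
      (WithLp.toLp 2 (d.fst + (ε / (4 * Dx ^ 2)) • (z.fst - z₀.fst),
        d.snd - (ε / (4 * Dy ^ 2)) • (z.snd - z₀.snd))) z := by
  refine hasGradientAt_of_inner (((hasGradientAt_iff_hasFDerivAt.1 h).add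
    ((hasFDerivAt_norm_fst_sub_sq z₀.fst z).const_mul (ε / (8 * Dx ^ 2)))).sub
    ((hasFDerivAt_norm_snd_sub_sq z₀.snd z).const_mul (ε / (8 * Dy ^ 2)))) fun v => ?_
  have h1 : WithLp.fstL 2 ℝ E F v = v.fst := rfl
  have h2 : WithLp.sndL 2 ℝ E F v = v.snd := rfl
  rw [inner_eq_fst_snd]
  simp [h1, h2, inner_eq_fst_snd d v, inner_add_left, inner_sub_left, real_inner_smul_left]
  ring

/-- `(x, y) ↦ (x, -y)`. -/
def negSnd (E F : Type) [NormedAddCommGroup E] [InnerProductSpace ℝ E]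
    [NormedAddCommGroup F] [InnerProductSpace ℝ F] :
    WithLp 2 (E × F) →ₗ[ℝ] WithLp 2 (E × F) where
  toFun z := WithLp.toLp 2 (z.fst, -z.snd)
  map_add' z z' := by
    apply WithLp.ofLp_injective
    ext
    · simp
    · simp [add_comm]
  map_smul' c z := by
    apply WithLp.ofLp_injective
    ext <;> simp

/-- The sign change is a linear isometry, so average smoothness passes from gradients to saddle
operators with the same constant. -/
theorem saddleGrad_eq_negSnd (φ : WithLp 2 (E × F) → ℝ) (z : WithLp 2 (E × F)) :
    saddleGrad φ z = negSnd E F (∇ φ z) :=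
  rfl

theorem norm_negSnd (z : WithLp 2 (E × F)) : ‖negSnd E F z‖ = ‖z‖ := by
  refine (sq_eq_sq₀ (norm_nonneg _) (norm_nonneg _)).1 ?_
  rw [norm_sq_eq_fst_snd, norm_sq_eq_fst_snd z]
  simp [negSnd]

theorem HasGradientAt.saddleGrad (h : HasGradientAt φ d z) :
    saddleGrad φ z = WithLp.toLp 2 (d.fst, -d.snd) := by
  rw [_root_.saddleGrad, h.gradient]

end Gradients

/-! ### The product feasible set. -/

section Feasible

variable {E F : Type} [NormedAddCommGroup E] [InnerProductSpace ℝ E]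
  [NormedAddCommGroup F] [InnerProductSpace ℝ F] {X : Set E} {Y : Set F}

theorem mk_mem_feasible {x : E} {y : F} (hx : x ∈ X) (hy : y ∈ Y) :
    WithLp.toLp 2 (x, y) ∈ feasible X Y :=
  ⟨hx, hy⟩

theorem convex_feasible (hX : Convex ℝ X) (hY : Convex ℝ Y) : Convex ℝ (feasible X Y) :=
  fun _ hz _ hz' _ _ ha hb hab => ⟨hX hz.1 hz'.1 ha hb hab, hY hz.2 hz'.2 ha hb hab⟩

theorem isClosed_feasible (hX : IsClosed X) (hY : IsClosed Y) : IsClosed (feasible X Y) :=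
  (hX.preimage (WithLp.continuous_fst 2 E F)).inter (hY.preimage (WithLp.continuous_snd 2 E F))

/-- This identifies the separate projected steps of AL-SVRE in x and y with a single projected step
along the saddle operator. -/
theorem proj_feasible [CompleteSpace E] [CompleteSpace F] (hX : Convex ℝ X) (hXc : IsClosed X)
    (hXn : X.Nonempty) (hY : Convex ℝ Y)
    (hYc : IsClosed Y) (hYn : Y.Nonempty) (z : WithLp 2 (E × F)) :
    proj (feasible X Y) z = WithLp.toLp 2 (proj X z.fst, proj Y z.snd) := by
  refine eq_proj_of_inner_nonpos (convex_feasible hX hY) (isClosed_feasible hXc hYc)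
    (mk_mem_feasible (proj_mem hX hXc hXn _) (proj_mem hY hYc hYn _)) fun v hv => ?_
  rw [inner_eq_fst_snd]
  exact add_nonpos (inner_sub_proj_nonpos hX hXc _ hv.1) (inner_sub_proj_nonpos hY hYc _ hv.2)

end Feasible

/-! ### First-order form of smooth saddle problems, stable under adding quadratics. -/

section Problem

variable {E F : Type} [NormedAddCommGroup E] [InnerProductSpace ℝ E] [CompleteSpace E]
  [NormedAddCommGroup F] [InnerProductSpace ℝ F] [CompleteSpace F]
  {n : ℕ} {f : Fin n → WithLp 2 (E × F) → ℝ} {X : Set E} {Y : Set F}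

/-- A finite-sum minimax problem that is `Λ`-average smooth, `μ`-strongly convex and
`ν`-strongly concave, in terms of gradients on `X × Y`. -/
structure SmoothSaddle (f : Fin n → WithLp 2 (E × F) → ℝ) (X : Set E) (Y : Set F)
    (Λ μ ν : ℝ) : Prop where
  differentiableAt : ∀ i, ∀ z ∈ feasible X Y, DifferentiableAt ℝ (f i) z
  averageLipschitz : AverageLipschitz (fun i => saddleGrad (f i)) (saddleGrad (average f))
    (feasible X Y) Λ
  convex_le : ∀ z ∈ feasible X Y, ∀ x ∈ X,
    average f z + ⟪(saddleGrad (average f) z).fst, x - z.fst⟫ + μ / 2 * ‖x - z.fst‖ ^ 2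
      ≤ average f (WithLp.toLp 2 (x, z.snd))
  le_concave : ∀ z ∈ feasible X Y, ∀ y ∈ Y,
    average f (WithLp.toLp 2 (z.fst, y)) + ν / 2 * ‖y - z.snd‖ ^ 2
      ≤ average f z - ⟪(saddleGrad (average f) z).snd, y - z.snd⟫

theorem hasGradientAt_average (hf : ∀ i, ∀ z ∈ feasible X Y, DifferentiableAt ℝ (f i) z)
    {z : WithLp 2 (E × F)} (hz : z ∈ feasible X Y) :
    HasGradientAt (average f) ((1 / (n : ℝ)) • ∑ i, ∇ (f i) z) z :=
  HasGradientAt.average fun i => (hf i z hz).hasGradientAt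

theorem saddleGrad_average (hf : ∀ i, ∀ z ∈ feasible X Y, DifferentiableAt ℝ (f i) z)
    {z : WithLp 2 (E × F)} (hz : z ∈ feasible X Y) :
    saddleGrad (average f) z = (1 / (n : ℝ)) • ∑ i, saddleGrad (f i) z := by
  simp only [saddleGrad_eq_negSnd]
  rw [(hasGradientAt_average hf hz).gradient, map_smul, map_sum]

/-- The partial derivatives of a differentiable function on the product. -/
theorem hasFDerivAt_mk_left {φ : WithLp 2 (E × F) → ℝ} {z : WithLp 2 (E × F)}
    (h : DifferentiableAt ℝ φ z) :
    ∃ φ' : E →L[ℝ] ℝ, HasFDerivAt (fun x => φ (WithLp.toLp 2 (x, z.snd))) φ' z.fst ∧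
      ∀ v, φ' v = ⟪(∇ φ z).fst, v⟫ := by
  have h1 : HasFDerivAt (fun x => WithLp.toLp 2 (x, z.snd))
      (((WithLp.prodContinuousLinearEquiv 2 ℝ E F).symm : E × F →L[ℝ] WithLp 2 (E × F)) ∘L
        ContinuousLinearMap.inl ℝ E F) z.fst :=
    ((WithLp.prodContinuousLinearEquiv 2 ℝ E F).symm : E × F →L[ℝ] WithLp 2 (E × F)).hasFDerivAt
      |>.comp z.fst (hasFDerivAt_prodMk_left z.fst z.snd)
  refine ⟨_, HasFDerivAt.comp z.fst (g := φ) (hasGradientAt_iff_hasFDerivAt.1 h.hasGradientAt)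
    h1, fun v => ?_⟩
  simp [← inner_gradient_left, WithLp.prod_inner_apply]

theorem hasFDerivAt_mk_right {φ : WithLp 2 (E × F) → ℝ} {z : WithLp 2 (E × F)}
    (h : DifferentiableAt ℝ φ z) :
    ∃ φ' : F →L[ℝ] ℝ, HasFDerivAt (fun y => φ (WithLp.toLp 2 (z.fst, y))) φ' z.snd ∧
      ∀ v, φ' v = ⟪(∇ φ z).snd, v⟫ := by
  have h1 : HasFDerivAt (fun y => WithLp.toLp 2 (z.fst, y))
      (((WithLp.prodContinuousLinearEquiv 2 ℝ E F).symm : E × F →L[ℝ] WithLp 2 (E × F)) ∘L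
        ContinuousLinearMap.inr ℝ E F) z.snd :=
    ((WithLp.prodContinuousLinearEquiv 2 ℝ E F).symm : E × F →L[ℝ] WithLp 2 (E × F)).hasFDerivAt
      |>.comp z.snd (hasFDerivAt_prodMk_right z.fst z.snd)
  refine ⟨_, HasFDerivAt.comp z.snd (g := φ) (hasGradientAt_iff_hasFDerivAt.1 h.hasGradientAt)
    h1, fun v => ?_⟩
  simp [← inner_gradient_left, WithLp.prod_inner_apply]

theorem smoothSaddle_of_convexConcave {L : ℝ} (hf : AverageSmooth f (feasible X Y) L)
    (hcc : ConvexConcave (average f) X Y) : SmoothSaddle f X Y L 0 0 where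
  differentiableAt := hf.1
  averageLipschitz := by
    refine ⟨fun z hz => saddleGrad_average hf.1 hz, fun z hz z' hz' => ?_⟩
    simp only [saddleGrad_eq_negSnd, ← map_sub, norm_negSnd]
    exact hf.2 z hz z' hz'
  convex_le z hz x hx := by
    obtain ⟨φ', h, h'⟩ := hasFDerivAt_mk_left (hasGradientAt_average hf.1 hz).differentiableAt
    have := (hcc.1 z.snd hz.2).add_fderiv_le hz.1 hx h
    have h1 : WithLp.toLp 2 (z.fst, z.snd) = z := rfl
    rw [h', h1] at this
    simpa [saddleGrad] using this
  le_concave z hz y hy := by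
    obtain ⟨φ', h, h'⟩ := hasFDerivAt_mk_right (hasGradientAt_average hf.1 hz).differentiableAt
    have := (hcc.2 z.fst hz.1).neg.add_fderiv_le hz.2 hy h.neg
    have h1 : WithLp.toLp 2 (z.fst, z.snd) = z := rfl
    simp only [Pi.neg_apply, neg_apply, h', h1] at this
    simp only [saddleGrad, WithLp.toLp_snd, zero_div, zero_mul, add_zero, inner_neg_left]
    linarith

/-- All components receive the same A, so the cross terms average to ⟪g z - g z', A z - A z'⟫ ≤ ΛB‖z
- z'‖². Together with the two squares this completes (Λ + B)². -/
theorem AverageLipschitz.add {V : Type} [NormedAddCommGroup V] [InnerProductSpace ℝ V] [NeZero n]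
    {G G' : Fin n → V → V} {g g' A : V → V} {Z : Set V} {Λ B : ℝ} (h : AverageLipschitz G g Z Λ)
    (hΛ : 0 ≤ Λ) (hB : 0 ≤ B)
    (hG : ∀ i, ∀ z ∈ Z, G' i z = G i z + A z) (hg : ∀ z ∈ Z, g' z = g z + A z)
    (hA : ∀ z ∈ Z, ∀ z' ∈ Z, ‖A z - A z'‖ ≤ B * ‖z - z'‖) :
    AverageLipschitz G' g' Z (Λ + B) where
  average_eq z hz := by
    have hn : (n : ℝ) ≠ 0 := by exact_mod_cast NeZero.ne n
    simp only [hg z hz, hG _ z hz, Finset.sum_add_distrib, Finset.sum_const, Finset.card_univ,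
      Fintype.card_fin, smul_add]
    rw [← h.average_eq z hz, ← Nat.cast_smul_eq_nsmul ℝ, smul_smul, one_div_mul_cancel hn,
      one_smul]
  sum_sq_le z hz z' hz' := by
    have hn : (n : ℝ) ≠ 0 := by exact_mod_cast NeZero.ne n
    have h1 : (1 / (n : ℝ)) * ∑ i, ‖G' i z - G' i z'‖ ^ 2
        = (1 / (n : ℝ)) * ∑ i, ‖G i z - G i z'‖ ^ 2 + 2 * ⟪g z - g z', A z - A z'⟫
          + ‖A z - A z'‖ ^ 2 := by
      have h2 : ∀ i, ‖G' i z - G' i z'‖ ^ 2 = ‖G i z - G i z'‖ ^ 2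
          + 2 * ⟪G i z - G i z', A z - A z'⟫ + ‖A z - A z'‖ ^ 2 := fun i => by
        rw [hG i z hz, hG i z' hz', add_sub_add_comm, norm_add_sq_real]
      simp only [h2, Finset.sum_add_distrib, Finset.sum_const, Finset.card_univ,
        Fintype.card_fin, nsmul_eq_mul, ← Finset.mul_sum, ← sum_inner]
      rw [h.average_eq z hz, h.average_eq z' hz', ← smul_sub, ← Finset.sum_sub_distrib,
        real_inner_smul_left]
      field_simp
    have h2 := h.sum_sq_le z hz z' hz'
    have h3 := (real_inner_le_norm (g z - g z') (A z - A z')).trans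
      (mul_le_mul (h.norm_sub_le hΛ hz hz') (hA z hz z' hz') (norm_nonneg _) (by positivity))
    have h4 := pow_le_pow_left₀ (norm_nonneg _) (hA z hz z' hz') 2
    rw [h1]
    linarith

theorem norm_toLp_smul_le {a b B : ℝ} (ha : 0 ≤ a) (hb : 0 ≤ b) (haB : a ≤ B) (hbB : b ≤ B)
    (z : WithLp 2 (E × F)) : ‖WithLp.toLp 2 (a • z.fst, b • z.snd)‖ ≤ B * ‖z‖ := by
  have := ha.trans haB
  refine le_of_sq_le_sq ?_ (by positivity)
  rw [mul_pow, norm_sq_eq_fst_snd, norm_sq_eq_fst_snd z]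
  simp only [WithLp.toLp_fst, WithLp.toLp_snd, norm_smul, mul_pow, Real.norm_eq_abs, sq_abs]
  rw [mul_add]
  gcongr

theorem norm_sub_sq_expand {V : Type} [NormedAddCommGroup V] [InnerProductSpace ℝ V] (x z u : V) :
    ‖x - u‖ ^ 2 = ‖z - u‖ ^ 2 + 2 * ⟪z - u, x - z⟫ + ‖x - z‖ ^ 2 := by
  rw [← norm_add_sq_real]
  congr 2
  abel

theorem average_proximal [NeZero n] (β : ℝ) (u : E) :
    average (fun i => proximal β u (f i)) = proximal β u (average f) := by
  have hn : (n : ℝ) ≠ 0 := by exact_mod_cast NeZero.ne n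
  funext z
  simp only [average, proximal, Finset.sum_add_distrib, Finset.sum_const, Finset.card_univ,
    Fintype.card_fin, nsmul_eq_mul]
  field_simp

theorem average_regularize [NeZero n] (ε Dx Dy : ℝ) (z₀ : WithLp 2 (E × F)) :
    average (fun i => regularize ε Dx Dy z₀ (f i)) = regularize ε Dx Dy z₀ (average f) := by
  have hn : (n : ℝ) ≠ 0 := by exact_mod_cast NeZero.ne n
  funext z
  simp only [average, regularize, Finset.sum_add_distrib, Finset.sum_sub_distrib,
    Finset.sum_const, Finset.card_univ, Fintype.card_fin, nsmul_eq_mul, mul_add, mul_sub]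
  rw [← mul_assoc (1 / (n : ℝ)) n, ← mul_assoc (1 / (n : ℝ)) n, one_div_mul_cancel hn, one_mul,
    one_mul]

theorem saddleGrad_proximal {φ : WithLp 2 (E × F) → ℝ} {z : WithLp 2 (E × F)}
    (h : DifferentiableAt ℝ φ z) (β : ℝ) (u : E) :
    saddleGrad (proximal β u φ) z = saddleGrad φ z + WithLp.toLp 2 (β • (z.fst - u), 0) := by
  rw [(h.hasGradientAt.proximal β u).saddleGrad, h.hasGradientAt.saddleGrad, ← WithLp.toLp_add]
  simp

theorem saddleGrad_regularize {φ : WithLp 2 (E × F) → ℝ} {z : WithLp 2 (E × F)}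
    (h : DifferentiableAt ℝ φ z) (ε Dx Dy : ℝ) (z₀ : WithLp 2 (E × F)) :
    saddleGrad (regularize ε Dx Dy z₀ φ) z = saddleGrad φ z
      + WithLp.toLp 2 ((ε / (4 * Dx ^ 2)) • (z.fst - z₀.fst),
          (ε / (4 * Dy ^ 2)) • (z.snd - z₀.snd)) := by
  rw [(h.hasGradientAt.regularize ε Dx Dy z₀).saddleGrad, h.hasGradientAt.saddleGrad,
    ← WithLp.toLp_add]
  simp only [WithLp.toLp_fst, WithLp.toLp_snd, Prod.mk_add_mk, sub_eq_neg_add,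
    neg_add_rev]
  simp [add_comm]

theorem SmoothSaddle.proximal [NeZero n] {Λ μ ν : ℝ} (h : SmoothSaddle f X Y Λ μ ν) (hΛ : 0 ≤ Λ)
    {β : ℝ} (hβ : 0 ≤ β) (u : E) :
    SmoothSaddle (fun i => proximal β u (f i)) X Y (Λ + β) (μ + β) ν where
  differentiableAt i z hz :=
    ((h.differentiableAt i z hz).hasGradientAt.proximal β u).differentiableAt
  averageLipschitz := by
    refine h.averageLipschitz.add hΛ hβ
      (A := fun z => WithLp.toLp 2 (β • (z.fst - u), 0))
      (fun i z hz => saddleGrad_proximal (h.differentiableAt i z hz) β u)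
      (fun z hz => ?_) fun z hz z' hz' => ?_
    · rw [average_proximal]
      exact saddleGrad_proximal (hasGradientAt_average h.differentiableAt hz).differentiableAt β u
    · have := norm_toLp_smul_le hβ le_rfl le_rfl hβ (z - z')
      simp only [zero_smul, WithLp.sub_fst] at this
      rw [← WithLp.toLp_sub]
      simpa [← smul_sub] using this
  convex_le z hz x hx := by
    have h1 := h.convex_le z hz x hx
    rw [average_proximal, saddleGrad_proximal
      (hasGradientAt_average h.differentiableAt hz).differentiableAt β u]
    simp only [_root_.proximal, WithLp.add_fst, WithLp.toLp_fst, inner_add_left,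
      real_inner_smul_left]
    rw [norm_sub_sq_expand x z.fst u]
    linarith
  le_concave z hz y hy := by
    have h1 := h.le_concave z hz y hy
    rw [average_proximal, saddleGrad_proximal
      (hasGradientAt_average h.differentiableAt hz).differentiableAt β u]
    simp only [_root_.proximal, WithLp.add_snd, WithLp.toLp_fst, WithLp.toLp_snd, add_zero]
    linarith

/-- A quadratic with coefficient ε/(8D²) has modulus ε/(4D²), twice the coefficient. -/
theorem SmoothSaddle.regularize [NeZero n] {Λ μ ν : ℝ} (h : SmoothSaddle f X Y Λ μ ν)
    (hΛ : 0 ≤ Λ) {ε Dx Dy B : ℝ} (hε : 0 ≤ ε) (hx : ε / (4 * Dx ^ 2) ≤ B)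
    (hy : ε / (4 * Dy ^ 2) ≤ B) (z₀ : WithLp 2 (E × F)) :
    SmoothSaddle (fun i => regularize ε Dx Dy z₀ (f i)) X Y (Λ + B) (μ + ε / (4 * Dx ^ 2))
      (ν + ε / (4 * Dy ^ 2)) where
  differentiableAt i z hz :=
    ((h.differentiableAt i z hz).hasGradientAt.regularize ε Dx Dy z₀).differentiableAt
  averageLipschitz := by
    have hx0 : 0 ≤ ε / (4 * Dx ^ 2) := by positivity
    refine h.averageLipschitz.add hΛ (hx0.trans hx)
      (A := fun z => WithLp.toLp 2 ((ε / (4 * Dx ^ 2)) • (z.fst - z₀.fst),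
          (ε / (4 * Dy ^ 2)) • (z.snd - z₀.snd)))
      (fun i z hz => saddleGrad_regularize (h.differentiableAt i z hz) ε Dx Dy z₀)
      (fun z hz => ?_) fun z hz z' hz' => ?_
    · rw [average_regularize]
      exact saddleGrad_regularize (hasGradientAt_average h.differentiableAt hz).differentiableAt
        ε Dx Dy z₀
    · have := norm_toLp_smul_le hx0 (by positivity) hx hy (z - z')
      rw [← WithLp.toLp_sub]
      simpa [← smul_sub] using this
  convex_le z hz x hx := by
    have h1 := h.convex_le z hz x hx
    rw [average_regularize, saddleGrad_regularize
      (hasGradientAt_average h.differentiableAt hz).differentiableAt]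
    simp only [_root_.regularize, WithLp.add_fst, WithLp.toLp_fst, WithLp.toLp_snd, inner_add_left,
      real_inner_smul_left]
    rw [norm_sub_sq_expand x z.fst z₀.fst]
    have h2 : ε / (8 * Dx ^ 2) = ε / (4 * Dx ^ 2) / 2 := by ring
    rw [h2]
    linarith
  le_concave z hz y hy := by
    have h1 := h.le_concave z hz y hy
    rw [average_regularize, saddleGrad_regularize
      (hasGradientAt_average h.differentiableAt hz).differentiableAt]
    simp only [_root_.regularize, WithLp.add_snd, WithLp.toLp_fst, WithLp.toLp_snd, inner_add_left,
      real_inner_smul_left]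
    rw [norm_sub_sq_expand y z.snd z₀.snd]
    have h2 : ε / (8 * Dy ^ 2) = ε / (4 * Dy ^ 2) / 2 := by ring
    rw [h2]
    linarith

/-- In the sum of the convexity and concavity inequalities at z and z', all values of the objective
cancel, including those at the mixed points (x', y) and (x, y'). -/
theorem SmoothSaddle.stronglyMonotoneOn {Λ μ ν m : ℝ} (h : SmoothSaddle f X Y Λ μ ν)
    (hμ : m ≤ μ) (hν : m ≤ ν) :
    StronglyMonotoneOn (saddleGrad (average f)) (feasible X Y) m := by
  intro z hz z' hz'
  have h1 := h.convex_le z hz z'.fst hz'.1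
  have h2 := h.convex_le z' hz' z.fst hz.1
  have h3 := h.le_concave z hz z'.snd hz'.2
  have h4 := h.le_concave z' hz' z.snd hz.2
  have h5 : m * ‖z.fst - z'.fst‖ ^ 2 ≤ μ * ‖z.fst - z'.fst‖ ^ 2 := by gcongr
  have h6 : m * ‖z.snd - z'.snd‖ ^ 2 ≤ ν * ‖z.snd - z'.snd‖ ^ 2 := by gcongr
  have h7 : WithLp.toLp 2 (z.fst, z.snd) = z := rfl
  have h8 : WithLp.toLp 2 (z'.fst, z'.snd) = z' := rfl
  rw [norm_sub_rev] at h1 h3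
  rw [norm_sq_eq_fst_snd, inner_eq_fst_snd]
  simp only [WithLp.sub_fst, WithLp.sub_snd, inner_sub_left, inner_sub_right] at *
  linarith

end Problem

/-! ### Inexact proximal points and the algebra of acceleration. -/

section InexactProx

variable {E F : Type} [NormedAddCommGroup E] [InnerProductSpace ℝ E] [CompleteSpace E]
  [NormedAddCommGroup F] [InnerProductSpace ℝ F] [CompleteSpace F]
  {n : ℕ} [NeZero n] {f : Fin n → WithLp 2 (E × F) → ℝ} {X : Set E} {Y : Set F}

/-- After a projected gradient step from a point near the solution, the variational inequality
holds up to an error proportional to the distance from the solution. -/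
theorem inner_proj_step_le {V : Type} [NormedAddCommGroup V] [InnerProductSpace ℝ V]
    [CompleteSpace V] {Z : Set V} {g : V → V} (hZ : Convex ℝ Z) (hc : IsClosed Z) {Λ τ D : ℝ}
    (hτ : 0 < τ) (hτΛ : τ * Λ ≤ 1 / 4) (hΛ : 0 ≤ Λ)
    (hg : ∀ z ∈ Z, ∀ z' ∈ Z, ‖g z - g z'‖ ≤ Λ * ‖z - z'‖)
    (hD : ∀ z ∈ Z, ∀ z' ∈ Z, ‖z - z'‖ ≤ D) {zs : V} (hzs : SolvesVI g Z zs) {z v : V}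
    (hz : z ∈ Z) (hv : v ∈ Z) :
    ⟪g (proj Z (z - τ • g z)), proj Z (z - τ • g z) - v⟫ ≤ 3 * D / τ * ‖z - zs‖ := by
  have h1 := inner_sub_proj_nonpos hZ hc (z - τ • g z) hv
  have h2 := norm_proj_sub_proj_le hZ hc ⟨v, hv⟩ (z - τ • g z) (zs - τ • g zs)
  rw [hzs.eq_proj hZ hc hτ.le] at h2
  have hu : proj Z (z - τ • g z) ∈ Z := proj_mem hZ hc ⟨v, hv⟩ _
  set u := proj Z (z - τ • g z)
  have hD0 : 0 ≤ D := (norm_nonneg _).trans (hD u hu v hv)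
  set r := ‖z - zs‖
  -- zs is a fixed point of the projected step, which is Lipschitz with constant 1 + τΛ ≤ 5/4.
  have h3 : ‖u - zs‖ ≤ 5 / 4 * r := by
    have h4 : z - τ • g z - (zs - τ • g zs) = (z - zs) - τ • (g z - g zs) := by
      rw [smul_sub]; abel
    have h5 := norm_sub_le (z - zs) (τ • (g z - g zs))
    rw [norm_smul, Real.norm_eq_abs, abs_of_pos hτ] at h5
    rw [h4] at h2
    have h6 : τ * ‖g z - g zs‖ ≤ 1 / 4 * r :=
      calc τ * ‖g z - g zs‖ ≤ τ * (Λ * r) := by gcongr; exact hg z hz zs hzs.1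
        _ = τ * Λ * r := by ring
        _ ≤ 1 / 4 * r := by gcongr
    linarith
  have h4 : ‖z - u‖ ≤ 9 / 4 * r := by
    have := norm_sub_le_norm_sub_add_norm_sub z zs u
    rw [norm_sub_rev zs u] at this
    linarith
  have h5 : τ * ⟪g z, u - v⟫ ≤ ‖z - u‖ * D := by
    have h6 : ⟪z - τ • g z - u, v - u⟫ = τ * ⟪g z, u - v⟫ - ⟪z - u, u - v⟫ := by
      rw [sub_right_comm, inner_sub_left, real_inner_smul_left, ← neg_sub u v, inner_neg_right,
        inner_neg_right]
      ring
    have h7 := (real_inner_le_norm (z - u) (u - v)).trans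
      (mul_le_mul_of_nonneg_left (hD u hu v hv) (norm_nonneg _))
    linarith
  have h6 : ⟪g u - g z, u - v⟫ ≤ Λ * ‖z - u‖ * D := by
    refine (real_inner_le_norm _ _).trans (mul_le_mul ?_ (hD u hu v hv) (norm_nonneg _)
      (by positivity))
    rw [norm_sub_rev z u]
    exact hg u hu z hz
  -- The constant is (1 + 1/4)·(9/4) = 45/16 ≤ 3.
  have h7 : τ * ⟪g u, u - v⟫ ≤ 3 * D * r := by
    have h8 : ⟪g u, u - v⟫ = ⟪g z, u - v⟫ + ⟪g u - g z, u - v⟫ := by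
      rw [← inner_add_left]
      congr 1
      abel
    have h9 : τ * ⟪g u - g z, u - v⟫ ≤ 1 / 4 * (‖z - u‖ * D) :=
      calc τ * ⟪g u - g z, u - v⟫ ≤ τ * (Λ * ‖z - u‖ * D) := by gcongr
        _ = τ * Λ * (‖z - u‖ * D) := by ring
        _ ≤ _ := by gcongr
    have h10 : ‖z - u‖ * D ≤ 9 / 4 * r * D := by gcongr
    have h11 : 0 ≤ r * D := by positivity
    rw [h8, mul_add]
    linarith
  rw [div_mul_eq_mul_div, le_div_iff₀ hτ]
  linarith

/-- `z` solves the proximal problem `min_x max_y φ(x, y) + (β/2) ‖x - u‖²` up to an error `e`, in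
the form in which the accelerated proximal point method uses it. -/
def IsInexactProx (φ : WithLp 2 (E × F) → ℝ) (X : Set E) (Y : Set F) (μ β : ℝ) (u : E) (e : ℝ)
    (z : WithLp 2 (E × F)) : Prop :=
  z ∈ feasible X Y ∧ ∀ x ∈ X, ∀ y ∈ Y,
    φ (WithLp.toLp 2 (z.fst, y)) + β * ⟪u - z.fst, x - z.fst⟫ + μ / 2 * ‖x - z.fst‖ ^ 2
      ≤ φ (WithLp.toLp 2 (x, z.snd)) + e

theorem SmoothSaddle.isInexactProx {L μ ν β e : ℝ} (h : SmoothSaddle f X Y L μ ν) (hν : 0 ≤ ν)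
    {u : E} {z : WithLp 2 (E × F)} (hz : z ∈ feasible X Y)
    (he : ∀ v ∈ feasible X Y,
      ⟪saddleGrad (average fun i => _root_.proximal β u (f i)) z, z - v⟫ ≤ e) :
    IsInexactProx (average f) X Y μ β u e z := by
  refine ⟨hz, fun x hx y hy => ?_⟩
  have h1 := h.convex_le z hz x hx
  have h2 := h.le_concave z hz y hy
  have h3 := he _ (mk_mem_feasible hx hy)
  have h4 : 0 ≤ ν / 2 * ‖y - z.snd‖ ^ 2 := by positivity
  rw [average_proximal, saddleGrad_proximal
    (hasGradientAt_average h.differentiableAt hz).differentiableAt, inner_eq_fst_snd] at h3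
  simp only [WithLp.add_fst, WithLp.add_snd, WithLp.sub_fst, WithLp.sub_snd, WithLp.toLp_fst,
    WithLp.toLp_snd, inner_add_left, inner_sub_left, inner_sub_right, real_inner_smul_left,
    inner_zero_left] at *
  linarith

/-- The primal function `max_{y ∈ Y} φ(x, y)`. -/
def primal (φ : WithLp 2 (E × F) → ℝ) (Y : Set F) (x : E) : ℝ :=
  sSup ((fun y => φ (WithLp.toLp 2 (x, y))) '' Y)

/-- A real `sSup` carries information only for bounded sets. The supergradient inequality and the
boundedness of Y provide this without compactness. -/
theorem SmoothSaddle.bddAbove {L μ ν : ℝ} (h : SmoothSaddle f X Y L μ ν) (hν : 0 ≤ ν)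
    (hY : Bornology.IsBounded Y) {x : E} (hx : x ∈ X) :
    BddAbove ((fun y => average f (WithLp.toLp 2 (x, y))) '' Y) := by
  rcases Y.eq_empty_or_nonempty with rfl | ⟨y₀, hy₀⟩
  · simp
  obtain ⟨C, hC⟩ := Metric.isBounded_iff.1 hY
  set z : WithLp 2 (E × F) := WithLp.toLp 2 (x, y₀) with hz
  refine ⟨average f z + ‖(saddleGrad (average f) z).snd‖ * C, ?_⟩
  rintro _ ⟨y, hy, rfl⟩
  have h1 := h.le_concave z (mk_mem_feasible hx hy₀) y hy
  have h2 : -⟪(saddleGrad (average f) z).snd, y - z.snd⟫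
      ≤ ‖(saddleGrad (average f) z).snd‖ * C := by
    refine (neg_le_abs _).trans ((abs_real_inner_le_norm _ _).trans ?_)
    gcongr
    rw [← dist_eq_norm]
    exact hC hy hy₀
  have h3 : 0 ≤ ν / 2 * ‖y - z.snd‖ ^ 2 := by positivity
  simp only [hz, WithLp.toLp_fst] at *
  linarith

theorem SmoothSaddle.le_primal {L μ ν : ℝ} (h : SmoothSaddle f X Y L μ ν) (hν : 0 ≤ ν)
    (hY : Bornology.IsBounded Y) {x : E} (hx : x ∈ X) {y : F} (hy : y ∈ Y) :
    average f (WithLp.toLp 2 (x, y)) ≤ primal (average f) Y x :=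
  le_csSup (h.bddAbove hν hY hx) ⟨y, hy, rfl⟩

/-- Taking the supremum over y on the left and φ(x, z.snd) ≤ max_y φ(x, y) on the right removes y:
what is left is an inexact proximal step for the primal function. -/
theorem SmoothSaddle.primal_le_of_isInexactProx {L μ ν β e : ℝ} (h : SmoothSaddle f X Y L μ ν)
    (hν : 0 ≤ ν) (hY : Bornology.IsBounded Y) {u : E} {z : WithLp 2 (E × F)}
    (hz : IsInexactProx (average f) X Y μ β u e z) {x : E} (hx : x ∈ X) :
    primal (average f) Y z.fst + β * ⟪u - z.fst, x - z.fst⟫ + μ / 2 * ‖x - z.fst‖ ^ 2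
      ≤ primal (average f) Y x + e := by
  have h1 : primal (average f) Y z.fst ≤ primal (average f) Y x + e
      - β * ⟪u - z.fst, x - z.fst⟫ - μ / 2 * ‖x - z.fst‖ ^ 2 := by
    refine csSup_le (Set.Nonempty.image _ ⟨_, hz.1.2⟩) ?_
    rintro _ ⟨y, hy, rfl⟩
    have h2 := hz.2 x hx y hy
    have h3 := h.le_primal hν hY hx hz.1.2
    simp only
    linarith
  linarith

/-- Quadratic growth is inherited from φ(·, ys) at the saddle point: this function lies below the
primal function and agrees with it at xs. -/
theorem SmoothSaddle.sq_norm_le_primal {L μ ν : ℝ} (h : SmoothSaddle f X Y L μ ν)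
    (hν : 0 ≤ ν) (hY : Bornology.IsBounded Y) {zs : WithLp 2 (E × F)}
    (hzs : SolvesVI (saddleGrad (average f)) (feasible X Y) zs) {x : E} (hx : x ∈ X) :
    primal (average f) Y zs.fst + μ / 2 * ‖x - zs.fst‖ ^ 2 ≤ primal (average f) Y x := by
  have h1 : primal (average f) Y zs.fst ≤ average f zs := by
    refine csSup_le (Set.Nonempty.image _ ⟨_, hzs.1.2⟩) ?_
    rintro _ ⟨y, hy, rfl⟩
    have h2 := h.le_concave zs hzs.1 y hy
    have h3 := hzs.2 _ (mk_mem_feasible hzs.1.1 hy)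
    have h4 : 0 ≤ ν / 2 * ‖y - zs.snd‖ ^ 2 := by positivity
    simp only [inner_eq_fst_snd, WithLp.sub_fst, WithLp.sub_snd, WithLp.toLp_fst,
      WithLp.toLp_snd, sub_self, inner_zero_right] at *
    linarith
  have h2 := h.convex_le zs hzs.1 x hx
  have h3 := hzs.2 _ (mk_mem_feasible hx hzs.1.2)
  have h4 := h.le_primal hν hY hx hzs.1.2
  simp only [inner_eq_fst_snd, WithLp.sub_fst, WithLp.sub_snd, WithLp.toLp_fst,
      WithLp.toLp_snd, sub_self, inner_zero_right] at *
  linarith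

/-- The quadratic inequality behind accelerated proximal point steps. -/
theorem accelerated_quadratic_nonneg {a μ β : ℝ} (ha : 0 < a) (ha1 : a ≤ 1) (hμ : 0 ≤ μ)
    (haβ : a ^ 2 * (μ + β) = μ) {x v w u x' xs : E} (hx' : x' = a • w + (1 - a) • x)
    (hu : (1 + a) • u = x + a • v) :
    0 ≤ (1 - a) * (μ / 2 * ‖v - xs‖ ^ 2) - μ / 2 * ‖w - xs‖ ^ 2
      + a * (β * ⟪u - x', xs - x'⟫ + μ / 2 * ‖xs - x'‖ ^ 2)
      + (1 - a) * (β * ⟪u - x', x - x'⟫ + μ / 2 * ‖x - x'‖ ^ 2) := by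
  -- With xs as origin, everything becomes a quadratic form in A, B, C.
  obtain ⟨A, rfl⟩ : ∃ A, x = A + xs := ⟨x - xs, by abel⟩
  obtain ⟨B, rfl⟩ : ∃ B, v = B + xs := ⟨v - xs, by abel⟩
  obtain ⟨C, rfl⟩ : ∃ C, w = C + xs := ⟨w - xs, by abel⟩
  have h1 : xs - x' = -(a • C + (1 - a) • A) := by rw [hx']; module
  have h2 : A + xs - x' = a • (A - C) := by rw [hx']; module
  have h3 : (1 + a) • (u - x') = a • (B - (1 + a) • C + a • A) := by
    rw [smul_sub, hu, hx']; module
  have h4 : a • (xs - x') + (1 - a) • (A + xs - x') = -(a • C) := by rw [hx']; module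
  have h5 : a * (β * ⟪u - x', xs - x'⟫) + (1 - a) * (β * ⟪u - x', A + xs - x'⟫)
      = -(μ * (1 - a) * ⟪B - (1 + a) • C + a • A, C⟫) := by
    have h6 : a * ⟪u - x', xs - x'⟫ + (1 - a) * ⟪u - x', A + xs - x'⟫ = -(a * ⟪u - x', C⟫) := by
      rw [← real_inner_smul_right, ← real_inner_smul_right, ← inner_add_right, h4,
        inner_neg_right, real_inner_smul_right]
    have h7 : (1 + a) * ⟪u - x', C⟫ = a * ⟪B - (1 + a) • C + a • A, C⟫ := by
      rw [← real_inner_smul_left, h3, real_inner_smul_left]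
    have h8 : β * a ^ 2 = μ * (1 - a) * (1 + a) := by linarith
    have h9 : (1 + a) ≠ 0 := by positivity
    refine mul_left_cancel₀ h9 ?_
    linear_combination (1 + a) * β * h6 - a * β * h7 - h8 * ⟪B - (1 + a) • C + a • A, C⟫
  have h6 : ‖-(a • C + (1 - a) • A)‖ ^ 2
      = a ^ 2 * ‖C‖ ^ 2 + 2 * (a * (1 - a)) * ⟪A, C⟫ + (1 - a) ^ 2 * ‖A‖ ^ 2 := by
    rw [norm_neg, norm_add_sq_real, norm_smul, norm_smul, mul_pow, mul_pow, Real.norm_eq_abs,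
      Real.norm_eq_abs, sq_abs, sq_abs, real_inner_smul_left, real_inner_smul_right,
      real_inner_comm]
    ring
  have h7 : ‖a • (A - C)‖ ^ 2 = a ^ 2 * (‖A‖ ^ 2 - 2 * ⟪A, C⟫ + ‖C‖ ^ 2) := by
    rw [norm_smul, mul_pow, norm_sub_sq_real, Real.norm_eq_abs, sq_abs]
  have h8 : ⟪B - (1 + a) • C + a • A, C⟫ = ⟪B, C⟫ - (1 + a) * ‖C‖ ^ 2 + a * ⟪A, C⟫ := by
    rw [inner_add_left, inner_sub_left, real_inner_smul_left, real_inner_smul_left,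
      real_inner_self_eq_norm_sq]
  -- The expression to be bounded is equal to this sum of squares.
  have h9 : 0 ≤ μ / 2 * ((1 - a) * ‖B - C‖ ^ 2 + a * (1 - a) * ‖C - A‖ ^ 2) := by
    have : 0 ≤ 1 - a := sub_nonneg.2 ha1
    positivity
  rw [norm_sub_sq_real, norm_sub_sq_real C A, real_inner_comm A C] at h9
  rw [mul_add a, mul_add (1 - a) (β * _)]
  rw [h8] at h5
  rw [add_sub_cancel_right, add_sub_cancel_right, h1, h2, h6, h7, ← h1, ← h2]
  linarith

end InexactProx

/-! ### Convergence and cost of AL-SVRE. -/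

section ALSVRE

variable {E F : Type} [NormedAddCommGroup E] [InnerProductSpace ℝ E] [CompleteSpace E]
  [NormedAddCommGroup F] [InnerProductSpace ℝ F] [CompleteSpace F]
  {n : ℕ} [NeZero n] {f : Fin n → WithLp 2 (E × F) → ℝ} {X : Set E} {Y : Set F}

/-- The conditions on problem and parameters under which AL-SVRE converges: `a = √q`, inner
contraction rate `θ`, and mean error `2σ` of the inner loops. -/
structure ALSVRESpec (f : Fin n → WithLp 2 (E × F) → ℝ) (X : Set E) (Y : Set F)
    (L μ ν β q m τ θ D Dx σ : ℝ) (T : ℕ) : Prop where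
  saddle : SmoothSaddle f X Y L μ ν
  convex_fst : Convex ℝ X
  closed_fst : IsClosed X
  convex_snd : Convex ℝ Y
  closed_snd : IsClosed Y
  bounded_snd : Bornology.IsBounded Y
  norm_sub_fst_le : ∀ x ∈ X, ∀ x' ∈ X, ‖x - x'‖ ≤ Dx
  norm_sub_le : ∀ z ∈ feasible X Y, ∀ z' ∈ feasible X Y, ‖z - z'‖ ≤ D
  L_pos : 0 < L
  μ_pos : 0 < μ
  ν_nonneg : 0 ≤ ν
  β_nonneg : 0 ≤ β
  q_eq : q = μ / (μ + β)
  m_pos : 0 < m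
  m_le_fst : m ≤ μ + β
  m_le_snd : m ≤ ν
  τ_eq : τ = 1 / (4 * √n * (L + β))
  θ_nonneg : 0 ≤ θ
  θ_le_prob : θ ≤ 1 / (16 * n)
  θ_le_step : θ ≤ τ * m / 4
  σ_pos : 0 < σ
  pow_le : 9 * D ^ 4 * (1 - θ) ^ T ≤ τ ^ 2 * σ ^ 2

/-- `s'` arises from `s` by an inexact proximal step with error `e` and the extrapolation. -/
def IsAcceleratedStep (φ : WithLp 2 (E × F) → ℝ) (X : Set E) (Y : Set F) (μ β a : ℝ)
    (s : ALSVREState E F) (e : ℝ) (s' : ALSVREState E F) : Prop :=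
  IsInexactProx φ X Y μ β s.u e s'.z ∧
    s'.u = s'.z.fst + ((1 - a) / (1 + a)) • (s'.z.fst - s.z.fst)

/-- The Lyapunov function of the accelerated proximal point method. -/
def alsvrePotential (φ : WithLp 2 (E × F) → ℝ) (Y : Set F) (μ a : ℝ) (xs : E)
    (s : ALSVREState E F) : ℝ :=
  primal φ Y s.z.fst - primal φ Y xs
    + μ / 2 * ‖s.z.fst + ((1 + a) / a) • (s.u - s.z.fst) - xs‖ ^ 2

variable {L μ ν β q m τ θ D Dx σ : ℝ} {T : ℕ}

namespace ALSVRESpec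

theorem Λ_pos (S : ALSVRESpec f X Y L μ ν β q m τ θ D Dx σ T) : 0 < L + β :=
  add_pos_of_pos_of_nonneg S.L_pos S.β_nonneg

theorem one_le_sqrt (_ : ALSVRESpec f X Y L μ ν β q m τ θ D Dx σ T) : 1 ≤ √(n : ℝ) :=
  Real.one_le_sqrt.2 (by exact_mod_cast NeZero.one_le)

theorem τ_pos (S : ALSVRESpec f X Y L μ ν β q m τ θ D Dx σ T) : 0 < τ := by
  have := S.Λ_pos
  have := S.one_le_sqrt
  rw [S.τ_eq]
  positivity

theorem τ_mul_eq (S : ALSVRESpec f X Y L μ ν β q m τ θ D Dx σ T) :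
    τ * (L + β) = 1 / (4 * √n) := by
  have := S.Λ_pos
  have := S.one_le_sqrt
  rw [S.τ_eq]
  field_simp

theorem τ_mul_le (S : ALSVRESpec f X Y L μ ν β q m τ θ D Dx σ T) : τ * (L + β) ≤ 1 / 4 := by
  have := S.one_le_sqrt
  rw [S.τ_mul_eq]
  gcongr
  linarith

theorem a_pos (S : ALSVRESpec f X Y L μ ν β q m τ θ D Dx σ T) : 0 < √q := by
  have := S.μ_pos
  have := S.β_nonneg
  rw [S.q_eq]
  positivity

theorem q_le_one (S : ALSVRESpec f X Y L μ ν β q m τ θ D Dx σ T) : q ≤ 1 := by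
  have := S.μ_pos
  have := S.β_nonneg
  rw [S.q_eq]
  exact div_le_one_of_le₀ (by linarith) (by linarith)

theorem a_le_one (S : ALSVRESpec f X Y L μ ν β q m τ θ D Dx σ T) : √q ≤ 1 :=
  Real.sqrt_le_one.2 S.q_le_one

theorem a_sq (S : ALSVRESpec f X Y L μ ν β q m τ θ D Dx σ T) : √q ^ 2 * (μ + β) = μ := by
  have := S.μ_pos
  have := S.β_nonneg
  rw [Real.sq_sqrt (Real.sqrt_pos.1 S.a_pos).le, S.q_eq]
  field_simp

/-- The mean error of the inner loop. -/
theorem expectation_alsvreStep_le (S : ALSVRESpec f X Y L μ ν β q m τ θ D Dx σ T)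
    {s : ALSVREState E F} (hs : s.z ∈ feasible X Y) {Ψ : ALSVREState E F → ℝ} {c d : ℝ}
    (hc : 0 ≤ c) (hd : 0 ≤ d)
    (hΨ : ∀ e s', 0 ≤ e → IsAcceleratedStep (average f) X Y μ β (√q) s e s' → Ψ s' ≤ c * e + d) :
    expectation (alsvreStep f X Y β q (refreshProb n) τ T s) (fun s' => ENNReal.ofReal (Ψ s'))
      ≤ ENNReal.ofReal (c * (2 * σ) + d) := by
  have hn : (1 : ℝ) ≤ n := by exact_mod_cast NeZero.one_le
  have hτ := S.τ_pos
  have hσ := S.σ_pos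
  have hZ := convex_feasible S.convex_fst S.convex_snd
  have hZc := isClosed_feasible S.closed_fst S.closed_snd
  have hD0 : 0 ≤ D := (norm_nonneg _).trans (S.norm_sub_le _ hs _ hs)
  have hF := S.saddle.proximal S.L_pos.le S.β_nonneg s.u
  have hmono := hF.stronglyMonotoneOn S.m_le_fst S.m_le_snd
  have hlip : ∀ z ∈ feasible X Y, ∀ z' ∈ feasible X Y, _ :=
    fun z hz z' hz' => hF.averageLipschitz.norm_sub_le S.Λ_pos.le hz hz'
  -- The solution of the current subproblem, which changes with `s.u`; its distance from the warm
  -- start is only estimated by D.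
  obtain ⟨zs, hzs⟩ := exists_solvesVI hZ hZc ⟨_, hs⟩ S.m_pos S.Λ_pos hmono hlip
  have hθ1 : 0 ≤ 1 - θ := by
    have h1 := S.θ_le_prob
    have h2 : 1 / (16 * (n : ℝ)) ≤ 1 := by
      rw [div_le_one (by positivity)]
      linarith
    linarith
  have hp : (refreshProb n : ℝ) = 1 / (2 * n) := rfl
  have hinner := expectation_lsvre_le hZ hZc (p := refreshProb n) (θ := θ) hF.averageLipschitz
    hmono hτ.le
    (by rw [hp]; gcongr; linarith)
    (by
      -- The step size is the largest allowed: τ²Λ² = 1/(16n) = p/8.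
      rw [← mul_pow, S.τ_mul_eq, hp, div_pow, mul_pow, Real.sq_sqrt (by positivity)]
      apply le_of_eq
      field_simp
      norm_num)
    S.θ_nonneg
    (S.θ_le_prob.trans (by
      rw [hp, div_div]
      gcongr 1 / ?_
      linarith)) S.θ_le_step hzs hs T
  rw [alsvreStep, expectation_map]
  -- The error is linear in the distance, while L-SVRE controls its square. By AM-GM, 3D/τ·r ≤ K r²
  -- + σ; `pow_le` makes the mean of K r² at most σ, hence 2σ in total.
  set K := 9 * D ^ 2 / (4 * τ ^ 2 * σ) with hK
  have hK0 : 0 ≤ K := by positivity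
  refine (expectation_le_affine (c := c * K) (d := c * σ + d) (by positivity) (by positivity)
    (by positivity) (fun r hr => ?_) hinner).trans
    (ENNReal.ofReal_le_ofReal ?_)
  · have hr1 : r.1 ∈ feasible X Y := lsvre_mem hZ hZc hs T hr
    set s' : ALSVREState E F := _
    change Ψ s' ≤ _
    have hs'z : s'.z = proj (feasible X Y)
        (r.1 - τ • saddleGrad (average fun i => _root_.proximal β s.u (f i)) r.1) := by
      rw [proj_feasible S.convex_fst S.closed_fst ⟨_, hs.1⟩ S.convex_snd S.closed_snd ⟨_, hs.2⟩]
      simp [saddleGrad, s']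
    have h1 : IsAcceleratedStep (average f) X Y μ β (√q) s (3 * D / τ * ‖r.1 - zs‖) s' := by
      refine ⟨S.saddle.isInexactProx S.ν_nonneg ?_ fun v hv => ?_, rfl⟩
      · rw [hs'z]
        exact proj_mem hZ hZc ⟨_, hs⟩ _
      · rw [hs'z]
        exact inner_proj_step_le hZ hZc hτ S.τ_mul_le S.Λ_pos.le hlip S.norm_sub_le hzs hr1 hv
    have h2 : 3 * D / τ * ‖r.1 - zs‖ ≤ K * ‖r.1 - zs‖ ^ 2 + σ := by
      have h3 : 0 ≤ (3 * D / (2 * τ) * ‖r.1 - zs‖ - σ) ^ 2 / σ := by positivity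
      have h4 : (3 * D / (2 * τ) * ‖r.1 - zs‖ - σ) ^ 2 / σ
          = K * ‖r.1 - zs‖ ^ 2 + σ - 3 * D / τ * ‖r.1 - zs‖ := by
        rw [hK]
        field_simp
        ring
      linarith
    have h3 := hΨ _ s' (by positivity) h1
    have h4 := mul_le_mul_of_nonneg_left h2 hc
    linarith
  · have h1 : K * (4 * (1 - θ) ^ T * ‖s.z - zs‖ ^ 2) ≤ σ := by
      calc K * (4 * (1 - θ) ^ T * ‖s.z - zs‖ ^ 2) ≤ K * (4 * (1 - θ) ^ T * D ^ 2) := by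
            gcongr
            exact S.norm_sub_le _ hs _ hzs.1
        _ = 9 * D ^ 4 * (1 - θ) ^ T / (τ ^ 2 * σ) := by
            rw [hK]
            field_simp
        _ ≤ τ ^ 2 * σ ^ 2 / (τ ^ 2 * σ) := by
            gcongr ?_ / _
            exact S.pow_le
        _ = σ := by field_simp
    have h2 := mul_le_mul_of_nonneg_left h1 hc
    linarith

theorem mem_of_alsvreStep (S : ALSVRESpec f X Y L μ ν β q m τ θ D Dx σ T)
    {s s' : ALSVREState E F} {p : unitInterval} (hs : s.z ∈ feasible X Y)
    (hs' : s' ∈ (alsvreStep f X Y β q p τ T s).support) : s'.z ∈ feasible X Y := by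
  rw [alsvreStep, PMF.mem_support_map_iff] at hs'
  obtain ⟨r, -, rfl⟩ := hs'
  exact mk_mem_feasible (proj_mem S.convex_fst S.closed_fst ⟨_, hs.1⟩ _)
    (proj_mem S.convex_snd S.closed_snd ⟨_, hs.2⟩ _)

theorem mem_of_alsvreState (S : ALSVRESpec f X Y L μ ν β q m τ θ D Dx σ T)
    {z₀ : WithLp 2 (E × F)} {p : unitInterval} (hz₀ : z₀ ∈ feasible X Y) (K : ℕ)
    {s : ALSVREState E F}
    (hs : s ∈ (alsvreState f X Y z₀ β q p (fun _ => τ) (fun _ => T) K).support) :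
    s.z ∈ feasible X Y := by
  induction K generalizing s with
  | zero =>
    simp only [alsvreState, PMF.mem_support_pure_iff] at hs
    subst hs
    exact hz₀
  | succ K ih =>
    simp only [alsvreState, PMF.mem_support_bind_iff] at hs
    obtain ⟨s', hs', h⟩ := hs
    exact S.mem_of_alsvreStep (ih hs') h

theorem sq_norm_le_potential (S : ALSVRESpec f X Y L μ ν β q m τ θ D Dx σ T)
    {zs : WithLp 2 (E × F)} (hzs : SolvesVI (saddleGrad (average f)) (feasible X Y) zs)
    {s : ALSVREState E F} (hs : s.z ∈ feasible X Y) :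
    μ / 2 * ‖s.z.fst - zs.fst‖ ^ 2
      + μ / 2 * ‖s.z.fst + ((1 + √q) / √q) • (s.u - s.z.fst) - zs.fst‖ ^ 2
      ≤ alsvrePotential (average f) Y μ (√q) zs.fst s := by
  have := S.saddle.sq_norm_le_primal S.ν_nonneg S.bounded_snd hzs hs.1
  rw [alsvrePotential]
  linarith

theorem potential_nonneg (S : ALSVRESpec f X Y L μ ν β q m τ θ D Dx σ T)
    {zs : WithLp 2 (E × F)} (hzs : SolvesVI (saddleGrad (average f)) (feasible X Y) zs)
    {s : ALSVREState E F} (hs : s.z ∈ feasible X Y) :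
    0 ≤ alsvrePotential (average f) Y μ (√q) zs.fst s := by
  have := S.μ_pos
  exact le_trans (by positivity) (S.sq_norm_le_potential hzs hs)

/-- The proximal inequality is used at xs with weight √q and at the old iterate with weight 1-√q;
the quadratic terms left over are handled by `accelerated_quadratic_nonneg`. -/
theorem potential_step_le (S : ALSVRESpec f X Y L μ ν β q m τ θ D Dx σ T)
    {zs : WithLp 2 (E × F)} (hzs : SolvesVI (saddleGrad (average f)) (feasible X Y) zs)
    {s s' : ALSVREState E F} (hs : s.z ∈ feasible X Y) {e : ℝ}
    (h : IsAcceleratedStep (average f) X Y μ β (√q) s e s') :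
    alsvrePotential (average f) Y μ (√q) zs.fst s'
      ≤ (1 - √q) * alsvrePotential (average f) Y μ (√q) zs.fst s + e := by
  have ha := S.a_pos
  have ha1 := S.a_le_one
  have h1 := S.saddle.primal_le_of_isInexactProx S.ν_nonneg S.bounded_snd h.1 hzs.1.1
  have h2 := S.saddle.primal_le_of_isInexactProx S.ν_nonneg S.bounded_snd h.1 hs.1
  have hu := h.2
  have haβ := S.a_sq
  set a := √q
  set w := s'.z.fst + ((1 + a) / a) • (s'.u - s'.z.fst) with hw
  set v := s.z.fst + ((1 + a) / a) • (s.u - s.z.fst) with hv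
  -- The extrapolation is designed so that the new iterate is a • w + (1 - a) • (old iterate).
  have hw' : w = s'.z.fst + ((1 - a) / a) • (s'.z.fst - s.z.fst) := by
    rw [hw, hu, add_sub_cancel_left, smul_smul]
    congr 2
    field_simp
  have h3 := accelerated_quadratic_nonneg ha ha1 S.μ_pos.le haβ (x := s.z.fst) (v := v) (w := w)
    (u := s.u) (x' := s'.z.fst) (xs := zs.fst)
    (by
      rw [hw', smul_add, smul_smul, mul_div_cancel₀ _ ha.ne']
      module)
    (by
      rw [hv, smul_add, smul_smul, mul_div_cancel₀ _ ha.ne']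
      module)
  have h4 := mul_le_mul_of_nonneg_left h1 ha.le
  have h5 := mul_le_mul_of_nonneg_left h2 (sub_nonneg.2 ha1)
  simp only [alsvrePotential]
  rw [← hw, ← hv]
  linarith

/-- The initial primal gap is not bounded by the parameters, but one proximal step brings it below e
+ βDx². The factor 1/√q in the extrapolated point is harmless because μ = q(μ + β). -/
theorem potential_first_step_le (S : ALSVRESpec f X Y L μ ν β q m τ θ D Dx σ T)
    {zs : WithLp 2 (E × F)} (hzs : SolvesVI (saddleGrad (average f)) (feasible X Y) zs)
    {s s' : ALSVREState E F} (hs : s.z ∈ feasible X Y) (hsu : s.u = s.z.fst) {e : ℝ}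
    (h : IsAcceleratedStep (average f) X Y μ β (√q) s e s') :
    alsvrePotential (average f) Y μ (√q) zs.fst s' ≤ e + 3 * (μ + β) * Dx ^ 2 := by
  have ha := S.a_pos
  have ha1 := S.a_le_one
  have hμ := S.μ_pos
  have hβ := S.β_nonneg
  have h1 := S.saddle.primal_le_of_isInexactProx S.ν_nonneg S.bounded_snd h.1 hzs.1.1
  have hu := h.2
  have haβ := S.a_sq
  have hDx := S.norm_sub_fst_le
  have hs' : s'.z.fst ∈ X := h.1.1.1
  have hDx0 : 0 ≤ Dx := (norm_nonneg _).trans (hDx _ hs' _ hs')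
  set a := √q
  set w := s'.z.fst + ((1 + a) / a) • (s'.u - s'.z.fst) with hw
  have hw' : a • (w - zs.fst) = a • (s.z.fst - zs.fst) + (s'.z.fst - s.z.fst) := by
    rw [hw, hu, add_sub_cancel_left, smul_smul, add_sub_right_comm, smul_add, smul_smul,
      show a * ((1 + a) / a * ((1 - a) / (1 + a))) = 1 - a by field_simp]
    module
  have h2 : a * ‖w - zs.fst‖ ≤ 2 * Dx := by
    calc a * ‖w - zs.fst‖ = ‖a • (w - zs.fst)‖ := by
          rw [norm_smul, Real.norm_eq_abs, abs_of_pos ha]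
      _ ≤ a * ‖s.z.fst - zs.fst‖ + ‖s'.z.fst - s.z.fst‖ := by
          rw [hw']
          refine (norm_add_le _ _).trans_eq ?_
          rw [norm_smul, Real.norm_eq_abs, abs_of_pos ha]
      _ ≤ 1 * Dx + Dx := by
          gcongr
          · exact hDx _ hs.1 _ hzs.1.1
          · exact hDx _ hs' _ hs.1
      _ = 2 * Dx := by ring
  have h3 : μ / 2 * ‖w - zs.fst‖ ^ 2 ≤ 2 * (μ + β) * Dx ^ 2 := by
    calc μ / 2 * ‖w - zs.fst‖ ^ 2 = (μ + β) / 2 * (a * ‖w - zs.fst‖) ^ 2 := by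
          rw [mul_pow]
          linear_combination (-‖w - zs.fst‖ ^ 2 / 2) * haβ
      _ ≤ (μ + β) / 2 * (2 * Dx) ^ 2 := by gcongr
      _ = _ := by ring
  have h4 : -(β * ⟪s.u - s'.z.fst, zs.fst - s'.z.fst⟫) ≤ β * Dx ^ 2 := by
    rw [← mul_neg]
    gcongr
    refine (neg_le_abs _).trans ((abs_real_inner_le_norm _ _).trans ?_)
    rw [pow_two, hsu]
    gcongr
    · exact hDx _ hs.1 _ hs'
    · exact hDx _ hzs.1.1 _ hs'
  have h5 : 0 ≤ μ / 2 * ‖zs.fst - s'.z.fst‖ ^ 2 := by positivity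
  have h6 : 0 ≤ μ * Dx ^ 2 := by positivity
  simp only [alsvrePotential]
  rw [← hw]
  linarith

/-- The proximal inequality bounds the gap by e + β‖x' - u‖Dx. Young's inequality splits the product
into μDx², a fixed fraction of ε, and a multiple of ‖x' - u‖², which the potential controls; no
estimate of the dual function is needed. -/
theorem dualityGap_step_le (S : ALSVRESpec f X Y L μ ν β q m τ θ D Dx σ T)
    {zs : WithLp 2 (E × F)} (hzs : SolvesVI (saddleGrad (average f)) (feasible X Y) zs)
    {s s' : ALSVREState E F} (hs : s.z ∈ feasible X Y) {e : ℝ}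
    (h : IsAcceleratedStep (average f) X Y μ β (√q) s e s') :
    dualityGap (average f) X Y s'.z ≤ (1 + (β / μ) ^ 2) * e
      + (μ * Dx ^ 2 + 2 * (β / μ) ^ 2 * alsvrePotential (average f) Y μ (√q) zs.fst s) := by
  have hμ := S.μ_pos
  have hβ := S.β_nonneg
  have ha := S.a_pos
  have h1 := S.potential_step_le hzs hs h
  have h2 := S.sq_norm_le_potential hzs hs
  have h3 := S.sq_norm_le_potential hzs h.1.1
  have hV := S.potential_nonneg hzs hs
  set V := alsvrePotential (average f) Y μ (√q) zs.fst s
  set V' := alsvrePotential (average f) Y μ (√q) zs.fst s'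
  have hDx := S.norm_sub_fst_le
  have hs' : s'.z.fst ∈ X := h.1.1.1
  have hDx0 : 0 ≤ Dx := (norm_nonneg _).trans (hDx _ hs' _ hs')
  set a := √q
  set v := s.z.fst + ((1 + a) / a) • (s.u - s.z.fst) with hv
  -- u is a convex combination of the iterate and v, and the potential bounds the distance of both
  -- from xs.
  have hu : s.u - zs.fst = (1 - a / (1 + a)) • s.z.fst + (a / (1 + a)) • v - zs.fst := by
    rw [hv, smul_add, smul_smul, show a / (1 + a) * ((1 + a) / a) = 1 by field_simp]
    module
  have h4 : μ / 2 * ‖s.u - zs.fst‖ ^ 2 ≤ V := by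
    rw [hu, norm_convex_comb_sub_sq]
    have h5 : a / (1 + a) ≤ 1 := by
      rw [div_le_one (by positivity)]
      linarith
    have h6 : 0 ≤ 1 - a / (1 + a) := sub_nonneg.2 h5
    have h7 : 0 ≤ a / (1 + a) * (1 - a / (1 + a)) * ‖s.z.fst - v‖ ^ 2 := by positivity
    have h8 : (1 - a / (1 + a)) * ‖s.z.fst - zs.fst‖ ^ 2 ≤ 1 * ‖s.z.fst - zs.fst‖ ^ 2 := by
      gcongr
      have : 0 ≤ a / (1 + a) := by positivity
      linarith
    have h9 : a / (1 + a) * ‖v - zs.fst‖ ^ 2 ≤ 1 * ‖v - zs.fst‖ ^ 2 := by gcongr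
    calc _ ≤ μ / 2 * (1 * ‖s.z.fst - zs.fst‖ ^ 2 + 1 * ‖v - zs.fst‖ ^ 2) := by
          gcongr
          linarith
      _ ≤ V := by linarith
  have h5 : μ / 2 * ‖s'.z.fst - zs.fst‖ ^ 2 ≤ V + e := by
    have h6 : 0 ≤ μ / 2 * ‖s'.z.fst + ((1 + a) / a) • (s'.u - s'.z.fst) - zs.fst‖ ^ 2 := by
      positivity
    have h7 : 0 ≤ a * V := by positivity
    linarith
  have h6 : μ * ‖s'.z.fst - s.u‖ ^ 2 ≤ 4 * (2 * V + e) := by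
    have h7 := norm_sub_sq_le_two_mul s'.z.fst zs.fst s.u
    rw [norm_sub_rev zs.fst] at h7
    have h8 := mul_le_mul_of_nonneg_left h7 hμ.le
    linarith
  have h7 : β * (‖s'.z.fst - s.u‖ * Dx) ≤ μ * Dx ^ 2 + (β / μ) ^ 2 * (2 * V + e) := by
    calc β * (‖s'.z.fst - s.u‖ * Dx)
        ≤ μ * Dx ^ 2 + β ^ 2 / (4 * μ) * ‖s'.z.fst - s.u‖ ^ 2 := by
          have h8 : 0 ≤ (2 * μ * Dx - β * ‖s'.z.fst - s.u‖) ^ 2 / (4 * μ) := by positivity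
          have h9 : (2 * μ * Dx - β * ‖s'.z.fst - s.u‖) ^ 2 / (4 * μ) = μ * Dx ^ 2
              + β ^ 2 / (4 * μ) * ‖s'.z.fst - s.u‖ ^ 2 - β * (‖s'.z.fst - s.u‖ * Dx) := by
            field_simp
            ring
          linarith
      _ = μ * Dx ^ 2 + (β / μ) ^ 2 / 4 * (μ * ‖s'.z.fst - s.u‖ ^ 2) := by
          field_simp
      _ ≤ μ * Dx ^ 2 + (β / μ) ^ 2 / 4 * (4 * (2 * V + e)) := by gcongr
      _ = _ := by ring
  have key : ∀ x ∈ X, ∀ y ∈ Y, average f (WithLp.toLp 2 (s'.z.fst, y))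
      ≤ average f (WithLp.toLp 2 (x, s'.z.snd)) + ((1 + (β / μ) ^ 2) * e
        + (μ * Dx ^ 2 + 2 * (β / μ) ^ 2 * V)) := fun x hx y hy => by
    have h8 := h.1.2 x hx y hy
    have h9 : -⟪s.u - s'.z.fst, x - s'.z.fst⟫ ≤ ‖s'.z.fst - s.u‖ * Dx := by
      refine (neg_le_abs _).trans ((abs_real_inner_le_norm _ _).trans ?_)
      rw [norm_sub_rev s.u]
      gcongr
      exact hDx _ hx _ hs'
    have h10 := mul_le_mul_of_nonneg_left h9 hβ
    have h11 : 0 ≤ μ / 2 * ‖x - s'.z.fst‖ ^ 2 := by positivity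
    linarith
  rw [dualityGap, sub_le_iff_le_add]
  refine csSup_le (Set.Nonempty.image _ ⟨_, hs.2⟩) ?_
  rintro _ ⟨y, hy, rfl⟩
  rw [← sub_le_iff_le_add']
  refine le_csInf (Set.Nonempty.image _ ⟨_, hs.1⟩) ?_
  rintro _ ⟨x, hx, rfl⟩
  rw [sub_le_iff_le_add]
  exact key x hx y hy

/-- The accumulated error 2σ/√q is the fixed point of t ↦ (1-√q)t + 2σ. -/
theorem expectation_potential_le (S : ALSVRESpec f X Y L μ ν β q m τ θ D Dx σ T)
    {zs z₀ : WithLp 2 (E × F)} (hzs : SolvesVI (saddleGrad (average f)) (feasible X Y) zs)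
    (hz₀ : z₀ ∈ feasible X Y) (k : ℕ) :
    expectation (alsvreState f X Y z₀ β q (refreshProb n) (fun _ => τ) (fun _ => T) (k + 1))
      (fun s => ENNReal.ofReal (alsvrePotential (average f) Y μ (√q) zs.fst s))
      ≤ ENNReal.ofReal ((1 - √q) ^ k * (2 * σ + 3 * (μ + β) * Dx ^ 2) + 2 * σ / √q) := by
  have ha := S.a_pos
  have ha1 : 0 ≤ 1 - √q := sub_nonneg.2 S.a_le_one
  have hσ := S.σ_pos
  have hμ := S.μ_pos
  have hβ := S.β_nonneg
  induction k with
  | zero =>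
    rw [alsvreState, alsvreState, PMF.pure_bind]
    refine (S.expectation_alsvreStep_le (c := 1) (d := 3 * (μ + β) * Dx ^ 2) hz₀ zero_le_one
      (by positivity) fun e s' _ h => ?_).trans (ENNReal.ofReal_le_ofReal ?_)
    · rw [one_mul]
      exact S.potential_first_step_le hzs hz₀ rfl h
    · have : 0 ≤ 2 * σ / √q := by positivity
      rw [pow_zero]
      linarith
  | succ k ih =>
    rw [alsvreState, expectation_bind]
    calc _ ≤ expectation
          (alsvreState f X Y z₀ β q (refreshProb n) (fun _ => τ) (fun _ => T) (k + 1))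
          (fun s => ENNReal.ofReal (2 * σ
            + (1 - √q) * alsvrePotential (average f) Y μ (√q) zs.fst s)) := by
          refine expectation_mono_of_support fun s hs => ?_
          have hs := S.mem_of_alsvreState hz₀ (k + 1) hs
          refine (S.expectation_alsvreStep_le (c := 1) hs zero_le_one
            (mul_nonneg ha1 (S.potential_nonneg hzs hs)) fun e s' _ h => ?_).trans_eq
            (by rw [one_mul])
          rw [one_mul, add_comm]
          exact S.potential_step_le hzs hs h
      _ ≤ _ := by
          refine (expectation_le_affine (d := 2 * σ) ha1 (by positivity) (by positivity)
            (fun s _ => (add_comm _ _).le) ih).trans_eq ?_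
          congr 1
          field_simp
          ring

/-- Of the k + 2 iterations, the first bounds the potential, k contract it, and the last turns it
into a gap. -/
theorem expectation_dualityGap_le (S : ALSVRESpec f X Y L μ ν β q m τ θ D Dx σ T)
    {z₀ : WithLp 2 (E × F)} (hz₀ : z₀ ∈ feasible X Y) (hμν : 0 < ν) (k : ℕ) :
    expectation (alsvreState f X Y z₀ β q (refreshProb n) (fun _ => τ) (fun _ => T) (k + 2))
      (fun s => ENNReal.ofReal (dualityGap (average f) X Y s.z))
      ≤ ENNReal.ofReal (2 * (β / μ) ^ 2 *
          ((1 - √q) ^ k * (2 * σ + 3 * (μ + β) * Dx ^ 2) + 2 * σ / √q)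
          + ((1 + (β / μ) ^ 2) * (2 * σ) + μ * Dx ^ 2)) := by
  have ha := S.a_pos
  have ha1 : 0 ≤ 1 - √q := sub_nonneg.2 S.a_le_one
  have hσ := S.σ_pos
  have hμ := S.μ_pos
  have hβ := S.β_nonneg
  obtain ⟨zs, hzs⟩ := exists_solvesVI (convex_feasible S.convex_fst S.convex_snd)
    (isClosed_feasible S.closed_fst S.closed_snd) ⟨_, hz₀⟩ (lt_min hμ hμν) S.L_pos
    (S.saddle.stronglyMonotoneOn (min_le_left _ _) (min_le_right _ _))
    (fun z hz z' hz' => S.saddle.averageLipschitz.norm_sub_le S.L_pos.le hz hz')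
  rw [alsvreState, expectation_bind]
  refine le_trans (expectation_mono_of_support fun s hs => ?_) (expectation_le_affine
    (c := 2 * (β / μ) ^ 2) (d := (1 + (β / μ) ^ 2) * (2 * σ) + μ * Dx ^ 2)
    (by positivity) (by positivity) (by positivity)
    (fun s _ => le_rfl) (S.expectation_potential_le hzs hz₀ k))
  have hs := S.mem_of_alsvreState hz₀ (k + 1) hs
  have hV := S.potential_nonneg hzs hs
  refine (S.expectation_alsvreStep_le hs (c := 1 + (β / μ) ^ 2) (by positivity) (by positivity)
    fun e s' _ h => S.dualityGap_step_le hzs hs h).trans_eq ?_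
  congr 1
  ring

end ALSVRESpec

theorem expectation_alsvreState_calls (z₀ : WithLp 2 (E × F)) (K : ℕ) :
    expectation (alsvreState f X Y z₀ β q (refreshProb n) (fun _ => τ) (fun _ => T) K)
      (fun s => (s.calls : ℝ≥0∞)) = ENNReal.ofReal (K * (2 * n + T * (5 / 2))) := by
  have step : ∀ s, expectation (alsvreStep f X Y β q (refreshProb n) τ T s)
      (fun s' => (s'.calls : ℝ≥0∞)) = s.calls + ENNReal.ofReal (2 * n + T * (5 / 2)) := fun s => by
    rw [alsvreStep, expectation_map]
    simp only [Nat.cast_add]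
    rw [expectation_add, expectation_add, expectation_const, expectation_const,
      expectation_lsvre_calls, add_assoc, ← ENNReal.ofReal_natCast n,
      ← ENNReal.ofReal_add (by positivity) (by positivity)]
    congr 2
    ring
  induction K with
  | zero => simp [alsvreState, expectation_pure]
  | succ K ih =>
    rw [alsvreState, expectation_bind]
    simp only [step]
    rw [expectation_add, expectation_const, ih, ← ENNReal.ofReal_add (by positivity)
      (by positivity)]
    congr 1
    push_cast
    ring

end ALSVRE

/-! ### The choice of β and its three regimes. -/

section Parameters

theorem natCast_rpow_three_quarters (n : ℕ) : (n : ℝ) ^ (3 / 4 : ℝ) = √√(n : ℝ) ^ 3 := by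
  have hn : (0 : ℝ) ≤ n := Nat.cast_nonneg n
  rw [Real.sqrt_eq_rpow, Real.sqrt_eq_rpow, ← Real.rpow_mul hn, ← Real.rpow_natCast,
    ← Real.rpow_mul hn]
  norm_num

variable {n : ℕ} [NeZero n] {L μ ν : ℝ}

theorem proxParam_nonneg (hμ : 0 < μ) (hμν : μ ≤ ν) : 0 ≤ proxParam n L μ ν := by
  have hn : 0 < √(n : ℝ) := Real.sqrt_pos.2 (by exact_mod_cast NeZero.pos n)
  rw [proxParam]
  split_ifs with h1 h2
  · linarith
  · rw [lt_div_iff₀ hμ] at h2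
    rw [sub_nonneg, le_div_iff₀ hn]
    linarith
  · exact le_rfl

theorem proxParam_le (hL : 0 ≤ L) (hμ : 0 < μ) (hνL : ν ≤ L) : proxParam n L μ ν ≤ L := by
  have hn : 1 ≤ √(n : ℝ) := Real.one_le_sqrt.2 (by exact_mod_cast NeZero.one_le)
  rw [proxParam]
  split_ifs with h1 h2
  · linarith
  · have := div_le_self hL hn
    linarith
  · exact hL

theorem add_proxParam_le (hL : 0 ≤ L) (hμ : 0 < μ) (hμν : μ ≤ ν) (hνL : ν ≤ L) :
    μ + proxParam n L μ ν ≤ L := by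
  have hn : 1 ≤ √(n : ℝ) := Real.one_le_sqrt.2 (by exact_mod_cast NeZero.one_le)
  rw [proxParam]
  split_ifs with h1 h2
  · linarith
  · have := div_le_self hL hn
    linarith
  · linarith

/-- The order of the product of outer and inner iteration numbers. -/
theorem sqrt_mul_proxParam_le (hμ : 0 < μ) (hμν : μ ≤ ν) (hνL : ν ≤ L) :
    √((μ + proxParam n L μ ν) / μ)
        * (n + √n * (L + proxParam n L μ ν) / min (μ + proxParam n L μ ν) ν)
      ≤ 3 * (n + √n * √(L / μ * (L / ν)) + (n : ℝ) ^ (3 / 4 : ℝ) * √(L / μ)) := by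
  have hν : 0 < ν := hμ.trans_le hμν
  have hL : 0 < L := hν.trans_le hνL
  have hn1 : (1 : ℝ) ≤ n := by exact_mod_cast NeZero.one_le
  obtain ⟨t, ht1, ht⟩ : ∃ t : ℝ, 1 ≤ t ∧ (n : ℝ) = t ^ 4 :=
    -- With t = n^(1/4), A = √κx and B = √κy all roots disappear, and the target is t⁴ + t²AB + t³A.
    ⟨√√n, Real.one_le_sqrt.2 (Real.one_le_sqrt.2 hn1), by
      rw [show √√(n : ℝ) ^ 4 = (√√(n : ℝ) ^ 2) ^ 2 by ring, Real.sq_sqrt (Real.sqrt_nonneg _),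
        Real.sq_sqrt (by positivity)]⟩
  have ht0 : 0 < t := by linarith
  have hs : √(n : ℝ) = t ^ 2 := by
    rw [ht, show t ^ 4 = (t ^ 2) ^ 2 by ring, Real.sqrt_sq (by positivity)]
  have h34 : (n : ℝ) ^ (3 / 4 : ℝ) = t ^ 3 := by
    rw [natCast_rpow_three_quarters, hs, Real.sqrt_sq ht0.le]
  obtain ⟨A, hA0, hA⟩ : ∃ A : ℝ, 0 < A ∧ L / μ = A ^ 2 :=
    ⟨√(L / μ), by positivity, (Real.sq_sqrt (by positivity)).symm⟩
  obtain ⟨B, hB0, hB⟩ : ∃ B : ℝ, 0 < B ∧ L / ν = B ^ 2 :=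
    ⟨√(L / ν), by positivity, (Real.sq_sqrt (by positivity)).symm⟩
  have hB1 : 1 ≤ B ^ 2 := by rw [← hB, one_le_div hν]; exact hνL
  have hμ' : μ = L / A ^ 2 := by rw [← hA]; field_simp
  have hν' : ν = L / B ^ 2 := by rw [← hB]; field_simp
  have hAB : √(A ^ 2 * B ^ 2) = A * B := by
    rw [← mul_pow, Real.sqrt_sq (by positivity)]
  rw [h34, hA, hB, hAB, Real.sqrt_sq hA0.le, hs]
  have hpos1 : 0 < t ^ 2 * (A * B) := by positivity
  have hpos2 : 0 < t ^ 3 * A := by positivity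
  rw [proxParam, hs, hA, hB]
  split_ifs with h1 h2
  -- Regime √n ≤ κy: 1/√q = A/B, the second summand gives 2t²AB, and t ≤ B turns t⁴A/B into at most
  -- t³A.
  · rw [add_sub_cancel, min_self, ht]
    have h3 : √(ν / μ) = A / B := by
      rw [hμ', hν', show L / B ^ 2 / (L / A ^ 2) = (A / B) ^ 2 by field_simp,
        Real.sqrt_sq (by positivity)]
    have h4 : t ≤ B := (pow_le_pow_iff_left₀ ht0.le hB0.le two_ne_zero).1 h1
    have h5 : t ^ 2 * (L + (ν - μ)) / ν ≤ t ^ 2 * (2 * B ^ 2) := by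
      rw [div_le_iff₀ hν, mul_assoc]
      gcongr
      have : B ^ 2 * ν = L := by rw [← hB]; field_simp
      linarith
    have h6 : t ^ 4 * (A / B) ≤ t ^ 3 * A := by
      rw [← mul_div_assoc, div_le_iff₀ hB0]
      calc t ^ 4 * A = t ^ 3 * A * t := by ring
        _ ≤ t ^ 3 * A * B := by gcongr
    calc √(ν / μ) * (t ^ 4 + t ^ 2 * (L + (ν - μ)) / ν)
        ≤ A / B * (t ^ 4 + t ^ 2 * (2 * B ^ 2)) := by rw [h3]; gcongr
      _ = t ^ 4 * (A / B) + 2 * (t ^ 2 * (A * B)) := by field_simp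
      _ ≤ 3 * (t ^ 4 + t ^ 2 * (A * B) + t ^ 3 * A) := by
          have : 0 < t ^ 4 := by positivity
          linarith
  -- Middle regime: 1/√q = A/t, and β balances the inner cost to at most 3n.
  · push Not at h1
    rw [add_sub_cancel]
    have h3 : √(L / t ^ 2 / μ) = A / t := by
      rw [hμ', show L / t ^ 2 / (L / A ^ 2) = (A / t) ^ 2 by field_simp,
        Real.sqrt_sq (by positivity)]
    have h4 : min (L / t ^ 2) ν = L / t ^ 2 := by
      rw [min_eq_left]
      rw [hν']
      gcongr
    have h5 : t ^ 2 * (L + (L / t ^ 2 - μ)) / (L / t ^ 2) ≤ 2 * t ^ 4 := by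
      rw [div_le_iff₀ (by positivity), show 2 * t ^ 4 * (L / t ^ 2) = t ^ 2 * (2 * L) by field_simp]
      gcongr
      have := div_le_self hL.le (one_le_pow₀ ht1 : 1 ≤ t ^ 2)
      linarith
    rw [h3, h4, ht]
    calc A / t * (t ^ 4 + t ^ 2 * (L + (L / t ^ 2 - μ)) / (L / t ^ 2))
        ≤ A / t * (t ^ 4 + 2 * t ^ 4) := by gcongr
      _ = 3 * (t ^ 3 * A) := by field_simp; ring
      _ ≤ 3 * (t ^ 4 + t ^ 2 * (A * B) + t ^ 3 * A) := by
          have : 0 < t ^ 4 := by positivity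
          linarith
  -- Here κx ≤ √n: no acceleration is needed, and the inner cost is at most 2n.
  · push Not at h2
    rw [add_zero, add_zero, min_eq_left hμν, div_self hμ.ne', Real.sqrt_one, mul_div_assoc, hA, ht]
    have h3 : t ^ 2 * A ^ 2 ≤ t ^ 2 * t ^ 2 := by gcongr
    have : 0 < t ^ 4 := by positivity
    linarith

theorem one_sub_pow_le_inv {θ x : ℝ} {T : ℕ} (hθ : 0 < θ) (hθ1 : θ ≤ 1) (hx : 0 < x)
    (hT : 1 / θ * Real.log x ≤ T) : (1 - θ) ^ T ≤ 1 / x := by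
  have h1 : 1 - θ ≤ Real.exp (-θ) := by
    have := Real.add_one_le_exp (-θ)
    linarith
  calc (1 - θ) ^ T ≤ Real.exp (-θ) ^ T := pow_le_pow_left₀ (by linarith) h1 T
    _ = Real.exp (-(θ * T)) := by rw [← Real.exp_nat_mul]; ring_nf
    _ ≤ Real.exp (-Real.log x) := by
        gcongr
        rw [one_div, inv_mul_le_iff₀ hθ] at hT
        exact hT
    _ = 1 / x := by rw [Real.exp_neg, Real.exp_log hx, one_div]

end Parameters

/-! ### Iteration numbers, and verification of the convergence conditions. -/

section Tuned

/-- Here R = 1/q, S = √R, k = κx, and R - 1 = β/μ. The terms in σ add up to at most 10ε/48, the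
decayed initial potential and μDx² = ε/8 contribute ε/8 each; the total is below ε/2. -/
theorem gap_bound_numeric {ε k R S σ r : ℝ} (hε : 0 < ε) (hR : 1 ≤ R) (hRk : R ≤ k) (hS : 0 ≤ S)
    (hSR : S ≤ R) (hσ : σ = ε / (48 * k ^ 3)) (hr : 0 ≤ r) (hrk : r ≤ 1 / (6 * k ^ 3)) :
    2 * (R - 1) ^ 2 * (r * (2 * σ + 3 * (R * (ε / 8))) + 2 * σ * S)
      + ((1 + (R - 1) ^ 2) * (2 * σ) + ε / 8) ≤ ε / 2 := by
  have hk : 1 ≤ k := hR.trans hRk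
  have hk3 : 1 ≤ k ^ 3 := one_le_pow₀ hk
  have hσ0 : 0 ≤ σ := by rw [hσ]; positivity
  have hσk : k ^ 3 * σ = ε / 48 := by rw [hσ]; field_simp
  have hrk' : r * k ^ 3 ≤ 1 / 6 := by
    rw [le_div_iff₀ (by positivity)] at hrk
    linarith
  have hr1 : r ≤ 1 := by nlinarith
  have h1 : (R - 1) ^ 2 ≤ k ^ 2 := pow_le_pow_left₀ (by linarith) (by linarith) 2
  have h2 : 1 + (R - 1) ^ 2 ≤ k ^ 2 := by nlinarith
  have hk23 : k ^ 2 ≤ k ^ 3 := pow_le_pow_right₀ hk (by norm_num)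
  calc 2 * (R - 1) ^ 2 * (r * (2 * σ + 3 * (R * (ε / 8))) + 2 * σ * S)
        + ((1 + (R - 1) ^ 2) * (2 * σ) + ε / 8)
      ≤ 2 * k ^ 2 * (r * (2 * σ + 3 * (k * (ε / 8))) + 2 * σ * k)
        + (k ^ 2 * (2 * σ) + ε / 8) := by
        gcongr
        exact hSR.trans hRk
    _ = 4 * (k ^ 2 * (r * σ)) + 3 / 4 * (r * k ^ 3) * ε + 4 * (k ^ 3 * σ) + 2 * (k ^ 2 * σ)
        + ε / 8 := by ring
    _ ≤ 4 * (k ^ 3 * (1 * σ)) + 3 / 4 * (1 / 6) * ε + 4 * (k ^ 3 * σ) + 2 * (k ^ 3 * σ)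
        + ε / 8 := by gcongr
    _ ≤ ε / 2 := by linarith

/-- The number of outer iterations. -/
def outerIterations (n : ℕ) (L Dx Dy ε : ℝ) : ℕ :=
  ⌈√((ε / (8 * Dx ^ 2) + proxParam n (2 * L) (ε / (8 * Dx ^ 2)) (ε / (8 * Dy ^ 2)))
      / (ε / (8 * Dx ^ 2))) * Real.log (6 * (16 * L * Dx ^ 2 / ε) ^ 3)⌉₊ + 2

/-- The reciprocal of the contraction rate of the inner loop, up to a factor `16`. -/
def innerComplexity (n : ℕ) (L Dx Dy ε : ℝ) : ℝ :=
  n + √n * (2 * L + proxParam n (2 * L) (ε / (8 * Dx ^ 2)) (ε / (8 * Dy ^ 2)))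
    / min (ε / (8 * Dx ^ 2) + proxParam n (2 * L) (ε / (8 * Dx ^ 2)) (ε / (8 * Dy ^ 2)))
      (ε / (8 * Dy ^ 2))

/-- The number of inner iterations. -/
def innerIterations (n : ℕ) (L Dx Dy ε : ℝ) : ℕ :=
  ⌈16 * innerComplexity n L Dx Dy ε * Real.log (82944 * n * (16 * L * Dx ^ 2 / ε) ^ 8)⌉₊

/-- Since κx, κy ≥ 4, the logarithm l of N = nκxκy is at least 1, so rounding up and additive
constants are absorbed into multiples of l: at most 7rl outer and 209Ql inner iterations. -/
theorem iterations_numeric {n r Q kx ky : ℝ} (hn1 : 1 ≤ n) (hkx4 : 4 ≤ kx) (hky : 4 ≤ ky)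
    (hR1 : 1 ≤ r) (hnQ : n ≤ Q) :
    ((⌈r * Real.log (6 * kx ^ 3)⌉₊ + 2 : ℕ) : ℝ)
        * (2 * n + (⌈16 * Q * Real.log (82944 * n * kx ^ 8)⌉₊ : ℝ) * (5 / 2))
      ≤ 3675 * (r * Q) * Real.log (n * kx * ky) ^ 2 := by
  have hQ1 : 1 ≤ Q := hn1.trans hnQ
  set N := n * kx * ky with hN
  have hkxky : 16 ≤ kx * ky := by nlinarith
  have hN16 : 16 ≤ N := by
    rw [hN, mul_assoc]
    nlinarith
  have hnk : n * kx ≤ N := by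
    rw [hN]
    exact le_mul_of_one_le_right (by positivity) (by linarith)
  have hkN : kx ≤ N := by
    refine le_trans ?_ hnk
    exact le_mul_of_one_le_left (by positivity) hn1
  set l := Real.log N with hl
  have hl1 : 1 ≤ l := by
    rw [hl, Real.le_log_iff_exp_le (by positivity)]
    have := Real.exp_one_lt_d9
    linarith
  have hlog1 : Real.log (6 * kx ^ 3) ≤ 4 * l := by
    have h1 : 6 * kx ^ 3 ≤ N ^ 4 := by
      calc 6 * kx ^ 3 ≤ N * N ^ 3 := by gcongr; linarith
        _ = N ^ 4 := by ring
    have h2 := Real.log_le_log (by positivity) h1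
    rw [Real.log_pow] at h2
    exact_mod_cast h2
  have hlog2 : Real.log (82944 * n * kx ^ 8) ≤ 13 * l := by
    have h1 : 82944 * n * kx ^ 8 ≤ N ^ 13 := by
      calc 82944 * n * kx ^ 8 ≤ 16 ^ 5 * (n * kx) * kx ^ 7 := by
            rw [show 82944 * n * kx ^ 8 = 82944 * (n * kx) * kx ^ 7 by ring]
            gcongr
            norm_num
        _ ≤ N ^ 5 * N * N ^ 7 := by gcongr
        _ = N ^ 13 := by ring
    have h2 := Real.log_le_log (by positivity) h1
    rw [Real.log_pow] at h2
    exact_mod_cast h2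
  have hlog1' : 0 ≤ Real.log (6 * kx ^ 3) := by
    refine Real.log_nonneg ?_
    have : 1 ≤ kx ^ 3 := one_le_pow₀ (by linarith)
    linarith
  have hlog2' : 0 ≤ Real.log (82944 * n * kx ^ 8) := by
    refine Real.log_nonneg ?_
    have : 1 ≤ kx ^ 8 := one_le_pow₀ (by linarith)
    nlinarith
  have hRl : 1 ≤ r * l := by nlinarith
  have hQl : 1 ≤ Q * l := by nlinarith
  have hK : ((⌈r * Real.log (6 * kx ^ 3)⌉₊ + 2 : ℕ) : ℝ) ≤ 7 * (r * l) := by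
    have h1 := (Nat.ceil_lt_add_one (mul_nonneg (by positivity) hlog1' :
      0 ≤ r * Real.log (6 * kx ^ 3))).le
    have h2 : r * Real.log (6 * kx ^ 3) ≤ r * (4 * l) := by gcongr
    push_cast
    linarith
  have hT : (⌈16 * Q * Real.log (82944 * n * kx ^ 8)⌉₊ : ℝ) ≤ 209 * (Q * l) := by
    have h1 := (Nat.ceil_lt_add_one (mul_nonneg (by positivity) hlog2' :
      0 ≤ 16 * Q * Real.log (82944 * n * kx ^ 8))).le
    have h2 : 16 * Q * Real.log (82944 * n * kx ^ 8) ≤ 16 * Q * (13 * l) := by gcongr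
    linarith
  have hnQl : n ≤ Q * l := by nlinarith
  have hsum : (2 * n + (⌈16 * Q * Real.log (82944 * n * kx ^ 8)⌉₊ : ℝ) * (5 / 2))
      ≤ 525 * (Q * l) := by linarith
  calc _ ≤ 7 * (r * l) * (525 * (Q * l)) := by gcongr
    _ = 3675 * (r * Q) * l ^ 2 := by ring

variable {n : ℕ} [NeZero n] {L Dx Dy ε : ℝ}

theorem calls_numeric (hε : 0 < ε) (hDx : 0 < Dx) (hDy : 0 < Dy) (hD : Dy ≤ Dx)
    (hεL : ε ≤ 4 * L * Dy ^ 2) :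
    (outerIterations n L Dx Dy ε : ℝ) * (2 * n + innerIterations n L Dx Dy ε * (5 / 2))
      ≤ 176400 * (n + √n * L * Dx * Dy / ε + (n : ℝ) ^ (3 / 4 : ℝ) * (Dx + Dy) * √(L / ε))
          * Real.log (n * (16 * L * Dx ^ 2 / ε) * (16 * L * Dy ^ 2 / ε)) ^ 2 := by
  have hL : 0 < L := by
    by_contra! h
    nlinarith [sq_nonneg Dy]
  have hn1 : (1 : ℝ) ≤ n := by exact_mod_cast NeZero.one_le
  have hky : 4 ≤ 16 * L * Dy ^ 2 / ε := by
    rw [le_div_iff₀ hε]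
    linarith
  have hkxy : 16 * L * Dy ^ 2 / ε ≤ 16 * L * Dx ^ 2 / ε := by gcongr
  have hμν : ε / (8 * Dx ^ 2) ≤ ε / (8 * Dy ^ 2) := by gcongr
  have hμ : 0 < ε / (8 * Dx ^ 2) := by positivity
  have hkx : 2 * L / (ε / (8 * Dx ^ 2)) = 16 * L * Dx ^ 2 / ε := by field_simp; norm_num
  have hkyν : 2 * L / (ε / (8 * Dy ^ 2)) = 16 * L * Dy ^ 2 / ε := by field_simp; norm_num
  have hνL : ε / (8 * Dy ^ 2) ≤ 2 * L := by
    rw [div_le_iff₀ (by positivity)]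
    nlinarith [mul_pos hL (pow_pos hDy 2)]
  have key := sqrt_mul_proxParam_le (n := n) hμ hμν hνL
  rw [hkx, hkyν] at key
  have hβ := proxParam_nonneg (n := n) (L := 2 * L) hμ hμν
  have hnQ : n ≤ innerComplexity n L Dx Dy ε := by
    rw [innerComplexity]
    have : 0 ≤ √n * (2 * L + proxParam n (2 * L) (ε / (8 * Dx ^ 2)) (ε / (8 * Dy ^ 2)))
      / min (ε / (8 * Dx ^ 2) + proxParam n (2 * L) (ε / (8 * Dx ^ 2)) (ε / (8 * Dy ^ 2)))
        (ε / (8 * Dy ^ 2)) := by positivity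
    linarith
  rw [← innerComplexity] at key
  rw [outerIterations, innerIterations]
  set Q := innerComplexity n L Dx Dy ε
  set R := (ε / (8 * Dx ^ 2) + proxParam n (2 * L) (ε / (8 * Dx ^ 2)) (ε / (8 * Dy ^ 2)))
    / (ε / (8 * Dx ^ 2)) with hR
  have hR1 : 1 ≤ √R := by
    rw [Real.one_le_sqrt, hR, one_le_div hμ]
    linarith
  have hroot : √(16 * L * Dx ^ 2 / ε * (16 * L * Dy ^ 2 / ε)) = 16 * (L * Dx * Dy / ε) := by
    rw [show 16 * L * Dx ^ 2 / ε * (16 * L * Dy ^ 2 / ε) = (16 * (L * Dx * Dy / ε)) ^ 2 by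
      field_simp, Real.sqrt_sq (by positivity)]
  have hroot' : √(16 * L * Dx ^ 2 / ε) = 4 * (Dx * √(L / ε)) := by
    rw [show 16 * L * Dx ^ 2 / ε = (4 * Dx) ^ 2 * (L / ε) by ring,
      Real.sqrt_mul (by positivity), Real.sqrt_sq (by positivity)]
    ring
  rw [hroot, hroot'] at key
  have hkx4 := hky.trans hkxy
  refine (iterations_numeric hn1 hkx4 hky hR1 hnQ).trans ?_
  set l := Real.log (n * (16 * L * Dx ^ 2 / ε) * (16 * L * Dy ^ 2 / ε))
  -- 176400 = 3675·3·16, with 3 from the regimes of β and 16 from √(κxκy) = 16LDxDy/ε.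
  calc 3675 * (√R * Q) * l ^ 2 ≤ 3675 * (3 * (n + √n * (16 * (L * Dx * Dy / ε))
          + (n : ℝ) ^ (3 / 4 : ℝ) * (4 * (Dx * √(L / ε))))) * l ^ 2 := by gcongr
    _ ≤ 3675 * (3 * (16 * (n + √n * L * Dx * Dy / ε
          + (n : ℝ) ^ (3 / 4 : ℝ) * (Dx + Dy) * √(L / ε)))) * l ^ 2 := by
        gcongr
        have h1 : 0 ≤ (n : ℝ) ^ (3 / 4 : ℝ) * Dy * √(L / ε) := by positivity
        have h2 : 0 ≤ (n : ℝ) ^ (3 / 4 : ℝ) * (Dx * √(L / ε)) := by positivity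
        have h3 : √n * L * Dx * Dy / ε = √n * (L * Dx * Dy / ε) := by ring
        rw [h3]
        linarith
    _ = _ := by ring

variable {E F : Type} [NormedAddCommGroup E] [InnerProductSpace ℝ E] [CompleteSpace E]
  [NormedAddCommGroup F] [InnerProductSpace ℝ F] [CompleteSpace F]
  {f : Fin n → WithLp 2 (E × F) → ℝ} {X : Set E} {Y : Set F} {z₀ : WithLp 2 (E × F)}

theorem SmoothSaddle.of_le_modulus {Λ μ ν μ' ν' : ℝ} (h : SmoothSaddle f X Y Λ μ ν) (hμ : μ' ≤ μ)
    (hν : ν' ≤ ν) : SmoothSaddle f X Y Λ μ' ν' where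
  differentiableAt := h.differentiableAt
  averageLipschitz := h.averageLipschitz
  convex_le z hz x hx := by
    have h1 := h.convex_le z hz x hx
    have h2 : μ' / 2 * ‖x - z.fst‖ ^ 2 ≤ μ / 2 * ‖x - z.fst‖ ^ 2 := by gcongr
    linarith
  le_concave z hz y hy := by
    have h1 := h.le_concave z hz y hy
    have h2 : ν' / 2 * ‖y - z.snd‖ ^ 2 ≤ ν / 2 * ‖y - z.snd‖ ^ 2 := by gcongr
    linarith

/-- The tuned parameters satisfy the conditions for convergence. -/
theorem alsvreSpec_tuned (hε : 0 < ε) (hDx : 0 < Dx) (hDy : 0 < Dy) (hD : Dy ≤ Dx)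
    (hεL : ε ≤ 4 * L * Dy ^ 2)
    (hX : Convex ℝ X) (hXc : IsClosed X) (hXb : Bornology.IsBounded X) (hXd : Metric.diam X = Dx)
    (hY : Convex ℝ Y) (hYc : IsClosed Y) (hYb : Bornology.IsBounded Y) (hYd : Metric.diam Y = Dy)
    (hf : AverageSmooth f (feasible X Y) L) (hcc : ConvexConcave (average f) X Y) :
    let μ := ε / (8 * Dx ^ 2)
    let ν := ε / (8 * Dy ^ 2)
    let β := proxParam n (2 * L) μ ν
    ALSVRESpec (fun i => regularize ε Dx Dy z₀ (f i)) X Y (2 * L) μ ν β (μ / (μ + β))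
      (min (μ + β) ν) (1 / (4 * √n * (2 * L + β))) (1 / (16 * innerComplexity n L Dx Dy ε))
      (√(Dx ^ 2 + Dy ^ 2)) Dx (ε / (48 * (16 * L * Dx ^ 2 / ε) ^ 3))
      (innerIterations n L Dx Dy ε) := by
  intro μ ν β
  have hL : 0 < L := by
    by_contra! h
    nlinarith [sq_nonneg Dy]
  have hn1 : (1 : ℝ) ≤ n := by exact_mod_cast NeZero.one_le
  have hs : 1 ≤ √(n : ℝ) := Real.one_le_sqrt.2 hn1
  have hμν : μ ≤ ν := by simp only [μ, ν]; gcongr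
  have hμ : 0 < μ := by simp only [μ]; positivity
  have hν : 0 < ν := hμ.trans_le hμν
  have hνL : ν ≤ 2 * L := by
    simp only [ν]
    rw [div_le_iff₀ (by positivity)]
    nlinarith [mul_pos hL (pow_pos hDy 2)]
  have hβ : 0 ≤ β := proxParam_nonneg hμ hμν
  have hβL : β ≤ 2 * L := proxParam_le (by linarith) hμ hνL
  have hm : 0 < min (μ + β) ν := lt_min (by linarith) hν
  have hQ : innerComplexity n L Dx Dy ε = n + √n * (2 * L + β) / min (μ + β) ν := rfl
  have hQ0 : 0 ≤ √n * (2 * L + β) / min (μ + β) ν := by positivity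
  have hQpos : 0 < innerComplexity n L Dx Dy ε := by rw [hQ]; linarith
  have hxL : ε / (4 * Dx ^ 2) ≤ L := by
    rw [div_le_iff₀ (by positivity)]
    have : L * Dy ^ 2 ≤ L * Dx ^ 2 := by gcongr
    linarith
  have hyL : ε / (4 * Dy ^ 2) ≤ L := by
    rw [div_le_iff₀ (by positivity)]
    linarith
  have hk : 0 < 16 * L * Dx ^ 2 / ε := by positivity
  have hdx : ∀ x ∈ X, ∀ x' ∈ X, ‖x - x'‖ ≤ Dx := fun x hx x' hx' => by
    rw [← dist_eq_norm, ← hXd]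
    exact Metric.dist_le_diam_of_mem hXb hx hx'
  have hdy : ∀ y ∈ Y, ∀ y' ∈ Y, ‖y - y'‖ ≤ Dy := fun y hy y' hy' => by
    rw [← dist_eq_norm, ← hYd]
    exact Metric.dist_le_diam_of_mem hYb hy hy'
  refine
    { saddle := ?_, convex_fst := hX, closed_fst := hXc, convex_snd := hY, closed_snd := hYc
      bounded_snd := hYb, norm_sub_fst_le := hdx, norm_sub_le := fun z hz z' hz' => ?_
      L_pos := by linarith, μ_pos := hμ, ν_nonneg := hν.le, β_nonneg := hβ, q_eq := rfl
      m_pos := hm, m_le_fst := min_le_left _ _, m_le_snd := min_le_right _ _, τ_eq := rfl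
      θ_nonneg := by positivity, θ_le_prob := ?_, θ_le_step := ?_, σ_pos := by positivity
      pow_le := ?_ }
  -- The added quadratics have gradients with Lipschitz constant at most L, whence 2L. The true
  -- moduli are twice μ and ν and are weakened here.
  · have h := (smoothSaddle_of_convexConcave hf hcc).regularize hL.le hε.le hxL hyL z₀
    rw [← two_mul, zero_add, zero_add] at h
    refine h.of_le_modulus ?_ ?_
    · simp only [μ]
      gcongr
      norm_num
    · simp only [ν]
      gcongr
      norm_num
  · refine Real.le_sqrt_of_sq_le ?_
    rw [norm_sq_eq_fst_snd]
    gcongr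
    · exact hdx _ hz.1 _ hz'.1
    · exact hdy _ hz.2 _ hz'.2
  · gcongr
    rw [hQ]
    linarith
  · have h1 : √n * (2 * L + β) / min (μ + β) ν ≤ innerComplexity n L Dx Dy ε := by
      rw [hQ]
      linarith
    rw [div_le_iff₀ hm] at h1
    rw [div_mul_eq_mul_div, one_mul, div_div, div_le_div_iff₀ (by positivity) (by positivity)]
    linarith
  · set k := 16 * L * Dx ^ 2 / ε with hkdef
    have hθ1 : 1 / (16 * innerComplexity n L Dx Dy ε) ≤ 1 := by
      rw [div_le_one (by positivity), hQ]
      linarith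
    have hpow := one_sub_pow_le_inv (θ := 1 / (16 * innerComplexity n L Dx Dy ε))
      (x := 82944 * n * k ^ 8) (T := innerIterations n L Dx Dy ε) (by positivity) hθ1
      (by positivity) (by rw [one_div_one_div]; exact Nat.le_ceil _)
    have hD4 : √(Dx ^ 2 + Dy ^ 2) ^ 4 ≤ 4 * Dx ^ 4 := by
      rw [show √(Dx ^ 2 + Dy ^ 2) ^ 4 = (√(Dx ^ 2 + Dy ^ 2) ^ 2) ^ 2 by ring,
        Real.sq_sqrt (by positivity), show 4 * Dx ^ 4 = (Dx ^ 2 + Dx ^ 2) ^ 2 by ring]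
      gcongr
    have hτ : 1 / (256 * n * L ^ 2) ≤ (1 / (4 * √n * (2 * L + β))) ^ 2 := by
      rw [div_pow, one_pow, mul_pow, mul_pow, Real.sq_sqrt (by positivity)]
      refine one_div_le_one_div_of_le (by positivity) ?_
      calc 4 ^ 2 * n * (2 * L + β) ^ 2 ≤ 4 ^ 2 * n * (2 * L + 2 * L) ^ 2 := by gcongr
        _ = 256 * n * L ^ 2 := by ring
    -- Expressed through k, all lengths and L cancel in the condition on T; 82944 = 9·4·48² is the
    -- constant that remains.
    have hεk : ε = 16 * L * Dx ^ 2 / k := by rw [hkdef]; field_simp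
    calc 9 * √(Dx ^ 2 + Dy ^ 2) ^ 4
          * (1 - 1 / (16 * innerComplexity n L Dx Dy ε)) ^ innerIterations n L Dx Dy ε
        ≤ 9 * (4 * Dx ^ 4) * (1 / (82944 * n * k ^ 8)) := by
          gcongr
      _ = 1 / (256 * n * L ^ 2) * (ε / (48 * k ^ 3)) ^ 2 := by
          rw [hεk]
          field_simp
          norm_num
      _ ≤ _ := by gcongr

end Tuned

/-! ### Convergence for Dy ≤ Dx, and the effect of regularisation on the gap. -/

section Tuned

variable {n : ℕ} [NeZero n] {L Dx Dy ε : ℝ}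
  {E F : Type} [NormedAddCommGroup E] [InnerProductSpace ℝ E] [CompleteSpace E]
  [NormedAddCommGroup F] [InnerProductSpace ℝ F] [CompleteSpace F]
  {f : Fin n → WithLp 2 (E × F) → ℝ} {X : Set E} {Y : Set F} {z₀ : WithLp 2 (E × F)}

/-- AL-SVRE on the regularised problem when the first variable has the larger diameter. -/
theorem alsvreTuned_convergence (hε : 0 < ε) (hDx : 0 < Dx) (hDy : 0 < Dy) (hD : Dy ≤ Dx)
    (hεL : ε ≤ 4 * L * Dy ^ 2)
    (hX : Convex ℝ X) (hXc : IsClosed X) (hXb : Bornology.IsBounded X) (hXd : Metric.diam X = Dx)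
    (hY : Convex ℝ Y) (hYc : IsClosed Y) (hYb : Bornology.IsBounded Y) (hYd : Metric.diam Y = Dy)
    (hz₀ : z₀ ∈ feasible X Y)
    (hf : AverageSmooth f (feasible X Y) L) (hcc : ConvexConcave (average f) X Y) :
    let fReg := fun i => regularize ε Dx Dy z₀ (f i)
    let run := alsvreTuned fReg X Y z₀ (2 * L) (ε / (8 * Dx ^ 2)) (ε / (8 * Dy ^ 2))
      (outerIterations n L Dx Dy ε) (innerIterations n L Dx Dy ε)
    (∀ r ∈ run.support, r.1 ∈ feasible X Y) ∧
    expectation run (fun r => ENNReal.ofReal (dualityGap (average fReg) X Y r.1))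
      ≤ ENNReal.ofReal (ε / 2) ∧
    expectation run (fun r => (r.2 : ℝ≥0∞))
      ≤ ENNReal.ofReal (176400 *
          (n + √n * L * Dx * Dy / ε + (n : ℝ) ^ (3 / 4 : ℝ) * (Dx + Dy) * √(L / ε))
          * Real.log (n * (16 * L * Dx ^ 2 / ε) * (16 * L * Dy ^ 2 / ε)) ^ 2) := by
  intro fReg run
  have S := alsvreSpec_tuned (z₀ := z₀) hε hDx hDy hD hεL hX hXc hXb hXd hY hYc hYb hYd hf hcc
  simp only at S
  have hL : 0 < L := by
    by_contra! h
    nlinarith [sq_nonneg Dy]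
  have hμν : ε / (8 * Dx ^ 2) ≤ ε / (8 * Dy ^ 2) := by gcongr
  have hμ : 0 < ε / (8 * Dx ^ 2) := by positivity
  have hν := hμ.trans_le hμν
  have hνL : ε / (8 * Dy ^ 2) ≤ 2 * L := by
    rw [div_le_iff₀ (by positivity)]
    nlinarith [mul_pos hL (pow_pos hDy 2)]
  have hcalls := calls_numeric (n := n) hε hDx hDy hD hεL
  have hβ := proxParam_nonneg (n := n) (L := 2 * L) hμ hμν
  have hβL := add_proxParam_le (n := n) (by linarith) hμ hμν hνL
  simp only [run, alsvreTuned, alsvre, expectation_map]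
  have hK : outerIterations n L Dx Dy ε = ⌈√((ε / (8 * Dx ^ 2)
      + proxParam n (2 * L) (ε / (8 * Dx ^ 2)) (ε / (8 * Dy ^ 2))) / (ε / (8 * Dx ^ 2)))
      * Real.log (6 * (16 * L * Dx ^ 2 / ε) ^ 3)⌉₊ + 2 := rfl
  refine ⟨fun r hr => ?_, ?_, ?_⟩
  · rw [PMF.mem_support_map_iff] at hr
    obtain ⟨s, hs, rfl⟩ := hr
    exact S.mem_of_alsvreState hz₀ _ hs
  · rw [hK]
    refine (S.expectation_dualityGap_le hz₀ hν _).trans (ENNReal.ofReal_le_ofReal ?_)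
    have ha := S.a_pos
    have ha1 := S.a_le_one
    have hkx : 2 * L / (ε / (8 * Dx ^ 2)) = 16 * L * Dx ^ 2 / ε := by field_simp; norm_num
    have hμD : ε / (8 * Dx ^ 2) * Dx ^ 2 = ε / 8 := by field_simp
    generalize proxParam n (2 * L) (ε / (8 * Dx ^ 2)) (ε / (8 * Dy ^ 2)) = β at *
    generalize ε / (8 * Dx ^ 2) = μ at *
    set R := (μ + β) / μ with hR
    have hR1 : 1 ≤ R := by
      rw [hR, one_le_div hμ]
      linarith
    have hRk : R ≤ 16 * L * Dx ^ 2 / ε := by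
      rw [hR, ← hkx]
      gcongr
    have hk : 1 ≤ 16 * L * Dx ^ 2 / ε := hR1.trans hRk
    have hq : √(μ / (μ + β)) = 1 / √R := by
      rw [hR, one_div, ← Real.sqrt_inv, inv_div]
    have hSR : √R ≤ R := Real.sqrt_le_iff.2 ⟨by linarith, by nlinarith⟩
    have hr := one_sub_pow_le_inv (θ := √(μ / (μ + β)))
      (x := 6 * (16 * L * Dx ^ 2 / ε) ^ 3)
      (T := ⌈√R * Real.log (6 * (16 * L * Dx ^ 2 / ε) ^ 3)⌉₊) ha ha1 (by positivity)
      (by rw [hq, one_div_one_div]; exact Nat.le_ceil _)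
    have key := gap_bound_numeric hε hR1 hRk (Real.sqrt_nonneg R) hSR rfl
      (pow_nonneg (sub_nonneg.2 ha1) _) hr
    have h1 : β / μ = R - 1 := by rw [hR]; field_simp; ring
    have h2 : 3 * (μ + β) * Dx ^ 2 = 3 * (R * (ε / 8)) := by
      rw [← hμD, hR]
      field_simp
    rw [h1, h2, hμD]
    refine le_trans (le_of_eq ?_) key
    rw [hq, div_div_eq_mul_div, div_one]
  · have h := expectation_alsvreState_calls (f := fReg) (X := X) (Y := Y)
      (β := proxParam n (2 * L) (ε / (8 * Dx ^ 2)) (ε / (8 * Dy ^ 2)))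
      (q := ε / (8 * Dx ^ 2) / (ε / (8 * Dx ^ 2)
        + proxParam n (2 * L) (ε / (8 * Dx ^ 2)) (ε / (8 * Dy ^ 2))))
      (τ := 1 / (4 * √n * (2 * L + proxParam n (2 * L) (ε / (8 * Dx ^ 2)) (ε / (8 * Dy ^ 2)))))
      (T := innerIterations n L Dx Dy ε) z₀ (outerIterations n L Dx Dy ε)
    rw [h]
    exact ENNReal.ofReal_le_ofReal hcalls

theorem SmoothSaddle.bddBelow {Λ μ ν : ℝ} (h : SmoothSaddle f X Y Λ μ ν) (hμ : 0 ≤ μ)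
    (hX : Bornology.IsBounded X) {y : F} (hy : y ∈ Y) :
    BddBelow ((fun x => average f (WithLp.toLp 2 (x, y))) '' X) := by
  rcases X.eq_empty_or_nonempty with rfl | ⟨x₀, hx₀⟩
  · simp
  obtain ⟨C, hC⟩ := Metric.isBounded_iff.1 hX
  set z : WithLp 2 (E × F) := WithLp.toLp 2 (x₀, y) with hz
  refine ⟨average f z - ‖(saddleGrad (average f) z).fst‖ * C, ?_⟩
  rintro _ ⟨x, hx, rfl⟩
  have h1 := h.convex_le z (mk_mem_feasible hx₀ hy) x hx
  have h2 : -⟪(saddleGrad (average f) z).fst, x - z.fst⟫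
      ≤ ‖(saddleGrad (average f) z).fst‖ * C := by
    refine (neg_le_abs _).trans ((abs_real_inner_le_norm _ _).trans ?_)
    gcongr
    rw [← dist_eq_norm]
    exact hC hx hx₀
  have h3 : 0 ≤ μ / 2 * ‖x - z.fst‖ ^ 2 := by positivity
  simp only [hz, WithLp.toLp_snd] at *
  linarith

/-- Regularisation changes the duality gap by at most `ε / 4`. -/
theorem dualityGap_le_regularize (hε : 0 < ε) (hDx : 0 < Dx) (hDy : 0 < Dy)
    (hεx : ε ≤ 4 * L * Dx ^ 2) (hεy : ε ≤ 4 * L * Dy ^ 2)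
    (hXb : Bornology.IsBounded X) (hXd : Metric.diam X = Dx)
    (hYb : Bornology.IsBounded Y) (hYd : Metric.diam Y = Dy)
    (hz₀ : z₀ ∈ feasible X Y)
    (hf : AverageSmooth f (feasible X Y) L) (hcc : ConvexConcave (average f) X Y)
    {z : WithLp 2 (E × F)} (hz : z ∈ feasible X Y) :
    dualityGap (average f) X Y z
      ≤ dualityGap (average fun i => regularize ε Dx Dy z₀ (f i)) X Y z + ε / 4 := by
  have hL : 0 < L := by
    by_contra! h
    nlinarith [sq_nonneg Dy]
  have h := (smoothSaddle_of_convexConcave hf hcc).regularize (Dx := Dx) (Dy := Dy) (B := L) hL.le hε.le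
    (by rw [div_le_iff₀ (by positivity)]; linarith)
    (by rw [div_le_iff₀ (by positivity)]; linarith) z₀
  have hA := h.bddAbove (by positivity) hYb hz.1
  have hB := h.bddBelow (by positivity) hXb hz.2
  rw [average_regularize] at hA hB ⊢
  have hx : ∀ x ∈ X, ε / (8 * Dx ^ 2) * ‖x - z₀.fst‖ ^ 2 ≤ ε / 8 := fun x hx => by
    have h1 : ‖x - z₀.fst‖ ≤ Dx := by
      rw [← dist_eq_norm, ← hXd]
      exact Metric.dist_le_diam_of_mem hXb hx hz₀.1
    calc ε / (8 * Dx ^ 2) * ‖x - z₀.fst‖ ^ 2 ≤ ε / (8 * Dx ^ 2) * Dx ^ 2 := by gcongr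
      _ = ε / 8 := by field_simp
  have hy : ∀ y ∈ Y, ε / (8 * Dy ^ 2) * ‖y - z₀.snd‖ ^ 2 ≤ ε / 8 := fun y hy => by
    have h1 : ‖y - z₀.snd‖ ≤ Dy := by
      rw [← dist_eq_norm, ← hYd]
      exact Metric.dist_le_diam_of_mem hYb hy hz₀.2
    calc ε / (8 * Dy ^ 2) * ‖y - z₀.snd‖ ^ 2 ≤ ε / (8 * Dy ^ 2) * Dy ^ 2 := by gcongr
      _ = ε / 8 := by field_simp
  have hP : 0 ≤ ε / (8 * Dx ^ 2) * ‖z.fst - z₀.fst‖ ^ 2 := by positivity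
  have hQ : 0 ≤ ε / (8 * Dy ^ 2) * ‖z.snd - z₀.snd‖ ^ 2 := by positivity
  have h1 : sSup ((fun y => average f (WithLp.toLp 2 (z.fst, y))) '' Y)
      ≤ sSup ((fun y => regularize ε Dx Dy z₀ (average f) (WithLp.toLp 2 (z.fst, y))) '' Y)
        + ε / 8 := by
    refine csSup_le (Set.Nonempty.image _ ⟨_, hz.2⟩) ?_
    rintro _ ⟨y, hyY, rfl⟩
    have h2 := le_csSup hA ⟨y, hyY, rfl⟩
    have h3 := hy y hyY
    simp only [regularize, WithLp.toLp_fst, WithLp.toLp_snd] at h2 ⊢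
    linarith
  have h2 : sInf ((fun x => regularize ε Dx Dy z₀ (average f) (WithLp.toLp 2 (x, z.snd))) '' X)
      ≤ sInf ((fun x => average f (WithLp.toLp 2 (x, z.snd))) '' X) + ε / 8 := by
    rw [← sub_le_iff_le_add]
    refine le_csInf (Set.Nonempty.image _ ⟨_, hz.1⟩) ?_
    rintro _ ⟨x, hxX, rfl⟩
    have h2 := csInf_le hB ⟨x, hxX, rfl⟩
    have h3 := hx x hxX
    simp only [regularize, WithLp.toLp_fst, WithLp.toLp_snd] at h2 ⊢
    linarith
  rw [dualityGap, dualityGap]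
  linarith

end Tuned

/-! ### Symmetry under exchange of the variables. -/

section Swap

variable {n : ℕ}
  {E F : Type} [NormedAddCommGroup E] [InnerProductSpace ℝ E]
  [NormedAddCommGroup F] [InnerProductSpace ℝ F]
  {f : Fin n → WithLp 2 (E × F) → ℝ} {X : Set E} {Y : Set F} {φ : WithLp 2 (E × F) → ℝ}

theorem norm_swapVars (z : WithLp 2 (E × F)) : ‖swapVars z‖ = ‖z‖ := by
  refine (sq_eq_sq₀ (norm_nonneg _) (norm_nonneg _)).1 ?_
  rw [WithLp.prod_norm_sq_eq_of_L2, WithLp.prod_norm_sq_eq_of_L2]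
  simp [swapVars, add_comm]

/-- Exchange of the variables as a linear isometry. -/
def swapIsometry (E F : Type) [NormedAddCommGroup E] [InnerProductSpace ℝ E]
    [NormedAddCommGroup F] [InnerProductSpace ℝ F] :
    WithLp 2 (E × F) →ₗᵢ[ℝ] WithLp 2 (F × E) where
  toFun := swapVars
  map_add' _ _ := rfl
  map_smul' _ _ := rfl
  norm_map' := norm_swapVars

theorem average_swapFun : average (fun i => swapFun (f i)) = swapFun (average f) := by
  funext z
  simp [average, swapFun]

theorem swapFun_regularize (ε Dx Dy : ℝ) (z₀ : WithLp 2 (E × F)) (φ : WithLp 2 (E × F) → ℝ) :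
    swapFun (regularize ε Dx Dy z₀ φ) = regularize ε Dy Dx (swapVars z₀) (swapFun φ) := by
  funext z
  simp only [regularize, swapFun, swapVars, WithLp.toLp_fst, WithLp.toLp_snd]
  ring

theorem swapVars_mem_feasible {z : WithLp 2 (F × E)} (hz : z ∈ feasible Y X) :
    swapVars z ∈ feasible X Y :=
  ⟨hz.2, hz.1⟩

/-- Negation exchanges supremum and infimum, so the two parts of the gap trade places. -/
theorem dualityGap_swapFun (z : WithLp 2 (F × E)) :
    dualityGap (swapFun φ) Y X z = dualityGap φ X Y (swapVars z) := by
  have h1 : (fun x => swapFun φ (WithLp.toLp 2 (z.fst, x))) '' X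
      = -((fun x => φ (WithLp.toLp 2 (x, (swapVars z).snd))) '' X) := by
    rw [← Set.image_neg_eq_neg, Set.image_image]
    rfl
  have h2 : (fun y => swapFun φ (WithLp.toLp 2 (y, z.snd))) '' Y
      = -((fun y => φ (WithLp.toLp 2 ((swapVars z).fst, y))) '' Y) := by
    rw [← Set.image_neg_eq_neg, Set.image_image]
    rfl
  rw [dualityGap, dualityGap, h1, h2, Real.sSup_neg, Real.sInf_neg]
  ring

theorem ConvexConcave.swapFun (h : ConvexConcave φ X Y) : ConvexConcave (swapFun φ) Y X :=
  ⟨fun x hx => (h.2 x hx).neg, fun y hy => (h.1 y hy).neg⟩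

theorem gradient_swapFun [CompleteSpace E] [CompleteSpace F] {z : WithLp 2 (F × E)}
    (h : DifferentiableAt ℝ φ (swapVars z)) :
    HasGradientAt (swapFun φ) (-swapVars (∇ φ (swapVars z))) z := by
  have h1 : HasFDerivAt (fun z : WithLp 2 (F × E) => swapVars z)
      (swapIsometry F E).toContinuousLinearMap z :=
    (swapIsometry F E).toContinuousLinearMap.hasFDerivAt
  refine hasGradientAt_of_inner
    ((hasGradientAt_iff_hasFDerivAt.1 h.hasGradientAt).comp z h1).neg fun v => ?_
  have h2 : (swapIsometry F E).toContinuousLinearMap v = swapVars v := rfl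
  simp only [neg_apply, ContinuousLinearMap.comp_apply, h2,
    InnerProductSpace.toDual_apply_apply, inner_neg_left]
  rw [inner_eq_fst_snd, inner_eq_fst_snd, add_comm]
  rfl

theorem AverageSmooth.swapFun [CompleteSpace E] [CompleteSpace F] {L : ℝ}
    (h : AverageSmooth f (feasible X Y) L) :
    AverageSmooth (fun i => swapFun (f i)) (feasible Y X) L := by
  refine ⟨fun i z hz =>
    (gradient_swapFun (h.1 i _ (swapVars_mem_feasible hz))).differentiableAt,
    fun z hz z' hz' => ?_⟩
  have h1 := h.2 _ (swapVars_mem_feasible hz) _ (swapVars_mem_feasible hz')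
  have h2 : ∀ i, ‖∇ (_root_.swapFun (f i)) z - ∇ (_root_.swapFun (f i)) z'‖
      = ‖∇ (f i) (swapVars z) - ∇ (f i) (swapVars z')‖ := fun i => by
    rw [(gradient_swapFun (h.1 i _ (swapVars_mem_feasible hz))).gradient,
      (gradient_swapFun (h.1 i _ (swapVars_mem_feasible hz'))).gradient, neg_sub_neg,
      ← norm_swapVars, norm_sub_rev]
    rfl
  have h3 : ‖z - z'‖ = ‖swapVars z - swapVars z'‖ := (norm_swapVars (z - z')).symm
  simp only [h2, h3]
  exact h1

end Swap

end

/-! ### The main theorem. -/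

theorem corollary3 :
    ∃ C : ℝ, 0 < C ∧
      ∀ (n : ℕ) [NeZero n] (L Dx Dy ε : ℝ), 0 < ε → ε ≤ 4 * L * min (Dx ^ 2) (Dy ^ 2) →
      ∃ K T : ℕ,
      ∀ (dx dy : ℕ) (X : Set (EuclideanSpace ℝ (Fin dx))) (Y : Set (EuclideanSpace ℝ (Fin dy)))
        (f : Fin n → WithLp 2 (EuclideanSpace ℝ (Fin dx) × EuclideanSpace ℝ (Fin dy)) → ℝ)
        (z₀ : WithLp 2 (EuclideanSpace ℝ (Fin dx) × EuclideanSpace ℝ (Fin dy))),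
        Convex ℝ X → IsClosed X → Bornology.IsBounded X → Metric.diam X = Dx →
        Convex ℝ Y → IsClosed Y → Bornology.IsBounded Y → Metric.diam Y = Dy →
        z₀ ∈ feasible X Y →
        AverageSmooth f (feasible X Y) L →
        ConvexConcave (average f) X Y →
        let fReg := fun i => regularize ε Dx Dy z₀ (f i)
        let run := alsvreOriented fReg X Y z₀ (2 * L) (ε / (8 * Dx ^ 2)) (ε / (8 * Dy ^ 2)) K T
        let κx := 16 * L * Dx ^ 2 / ε
        let κy := 16 * L * Dy ^ 2 / ε
        (∀ r ∈ run.support, r.1 ∈ feasible X Y) ∧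
        expectation run (fun r => ENNReal.ofReal (dualityGap (average fReg) X Y r.1))
          ≤ ENNReal.ofReal (ε / 2) ∧
        (∀ z, IsEpsSaddle (average fReg) X Y (ε / 2) z → IsEpsSaddle (average f) X Y ε z) ∧
        expectation run (fun r => ENNReal.ofReal (dualityGap (average f) X Y r.1))
          ≤ ENNReal.ofReal ε ∧
        expectation run (fun r => (r.2 : ℝ≥0∞))
          ≤ ENNReal.ofReal (C *
              (n + √n * L * Dx * Dy / ε + (n : ℝ) ^ (3 / 4 : ℝ) * (Dx + Dy) * √(L / ε))
              * Real.log (n * κx * κy) ^ 2) := by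
  refine ⟨176400, by norm_num, fun n _ L Dx Dy ε hε hεL => ?_⟩
  -- The iteration numbers follow the same case distinction as `alsvreOriented` and are fixed before
  -- the problem is given.
  refine ⟨if ε / (8 * Dx ^ 2) ≤ ε / (8 * Dy ^ 2) then outerIterations n L Dx Dy ε
      else outerIterations n L Dy Dx ε,
    if ε / (8 * Dx ^ 2) ≤ ε / (8 * Dy ^ 2) then innerIterations n L Dx Dy ε
      else innerIterations n L Dy Dx ε, ?_⟩
  intro dx dy X Y f z₀ hX hXc hXb hXd hY hYc hYb hYd hz₀ hf hcc fReg run κx κy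
  have hL : 0 < L := by
    by_contra! h
    have : 0 ≤ min (Dx ^ 2) (Dy ^ 2) := by positivity
    nlinarith
  have hmin : 0 < min (Dx ^ 2) (Dy ^ 2) := by
    by_contra! h
    nlinarith
  have hεx : ε ≤ 4 * L * Dx ^ 2 := hεL.trans (by gcongr; exact min_le_left _ _)
  have hεy : ε ≤ 4 * L * Dy ^ 2 := hεL.trans (by gcongr; exact min_le_right _ _)
  -- A zero diameter would contradict 0 < ε ≤ 4L min(Dx², Dy²).
  have hDx : 0 < Dx := lt_of_le_of_ne (hXd ▸ Metric.diam_nonneg) fun h => by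
    simp [← h] at hmin
  have hDy : 0 < Dy := lt_of_le_of_ne (hYd ▸ Metric.diam_nonneg) fun h => by
    simp [← h] at hmin
  have hgap : ∀ {z}, z ∈ feasible X Y → dualityGap (average f) X Y z
      ≤ 1 * dualityGap (average fReg) X Y z + ε / 4 := fun hz => by
    rw [one_mul]
    exact dualityGap_le_regularize hε hDx hDy hεx hεy hXb hXd hYb hYd hz₀ hf hcc hz
  have main : (∀ r ∈ run.support, r.1 ∈ feasible X Y) ∧
      expectation run (fun r => ENNReal.ofReal (dualityGap (average fReg) X Y r.1))
        ≤ ENNReal.ofReal (ε / 2) ∧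
      expectation run (fun r => (r.2 : ℝ≥0∞))
        ≤ ENNReal.ofReal (176400 *
          (n + √n * L * Dx * Dy / ε + (n : ℝ) ^ (3 / 4 : ℝ) * (Dx + Dy) * √(L / ε))
          * Real.log (n * κx * κy) ^ 2) := by
    simp only [run, alsvreOriented]
    split_ifs with h
    · have hD : Dy ≤ Dx := by
        rw [div_le_div_iff_of_pos_left hε (by positivity) (by positivity)] at h
        exact (pow_le_pow_iff_left₀ hDy.le hDx.le two_ne_zero).1 (by linarith)
      exact alsvreTuned_convergence hε hDx hDy hD hεy hX hXc hXb hXd hY hYc hYb hYd hz₀ hf hcc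
    · have hD : Dx ≤ Dy := by
        rw [not_le, div_lt_div_iff_of_pos_left hε (by positivity) (by positivity)] at h
        exact (pow_le_pow_iff_left₀ hDx.le hDy.le two_ne_zero).1 (by linarith)
      have key := alsvreTuned_convergence (z₀ := swapVars z₀) hε hDy hDx hD hεx hY hYc hYb hYd hX
        hXc hXb hXd (swapVars_mem_feasible hz₀) hf.swapFun
        (by rw [average_swapFun]; exact hcc.swapFun)
      simp only [← swapFun_regularize, average_swapFun, dualityGap_swapFun] at key
      refine ⟨fun r hr => ?_, ?_, ?_⟩
      · rw [PMF.mem_support_map_iff] at hr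
        obtain ⟨r', hr', rfl⟩ := hr
        exact swapVars_mem_feasible (key.1 r' hr')
      · rw [expectation_map]
        exact key.2.1
      · rw [expectation_map]
        -- The cost bound is symmetric in the two variables.
        refine key.2.2.trans_eq ?_
        congr 1
        rw [mul_right_comm (n : ℝ) (16 * L * Dy ^ 2 / ε), add_comm Dy Dx,
          mul_right_comm (√(n : ℝ) * L) Dy Dx]
  obtain ⟨h1, h2, h3⟩ := main
  refine ⟨h1, h2, fun z hz => ⟨hz.1, ?_⟩, ?_, h3⟩
  · have h4 := hgap hz.1
    have h5 := hz.2
    linarith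
  -- The expected gap of f is at most ε/2 + ε/4.
  · exact (expectation_le_affine (c := 1) (r := ε / 2) zero_le_one (by positivity)
      (by positivity) (fun r hr => hgap (h1 r hr)) h2).trans
      (ENNReal.ofReal_le_ofReal (by linarith))
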